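/- Let $\Gamma$ be a countable infinite connected (simple) graph with symmetric weights $\mu_{x,y}=\mu_{y,x}$, positive if $x\sim y$ and zero otherwise. Put $\mu(x)=\sum_{y}\mu_{x,y}$, which is assumed finite, $P(x,y)=\mu_{x,y}/\mu(x)$, $\Delta f(x)=\sum_y P(x,y)f(y)-f(x)$ and $(f,g)_\mu=\sum_x f(x)g(x)\mu(x)$. Let $d$ be the graph distance and $B(x,R)=\{y: d(x,y)<R\}$ for real $R$. For disjoint $A,B\subset\Gamma$ let $$\rho(A,B)=\Big(\inf\{(-\Delta f,f)_\mu : f \text{ finitely supported},\ f|_A=1,\ f|_B=0\}\Big)^{-1}\in[0,\infty],$$ and let $\rho(x,r,R)=\rho(B(x,r),\Gamma\setminus B(x,R))$ for $0\le r\le R$. Consider the conditions: - $(p_0)$: there is $p_0>0$ such that $\mu_{x,y}/\mu(x)\ge p_0$ for all $x\sim y$. - $(H)$ (elliptic Harnack inequality): there is $H>1$ such that for all $x\in\Gamma$, $R>0$ and every $u\ge 0$ defined on $B(x,2R)$ and the neighbours of its points, with $\sum_z P(y,z)u(z)=u(y)$ for all $y\in B(x,2R)$, one has $\max_{B(x,R)}u\le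 H\min_{B(x,R)}u$. - $(BC)$ (bounded covering): there is an integer $K$ such that for all $x\in\Gamma$, $R>0$ the ball $B(x,2R)$ can be covered by at most $K$ balls of radius $R$. Assume that $(\Gamma,\mu)$ satisfies $(p_0)$ and $(H)$. Then there is a constant $C_2>1$ such that for all $x\in\Gamma$ and all real $R\ge 0$ $$\rho(x,R,4R)\le C_2\,\rho(x,2R,4R).$$ If in addition $(BC)$ holds, then there is a constant $C_1>1$ such that for all $x\in\Gamma$ and all real $R\ge 0$ $$\rho(x,R,4R)\le C_1\,\rho(x,R,2R).$$ -/

import Mathlib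

open scoped ENNReal NNReal

/-- A connected graph with symmetric weights `w x y = w y x`, positive exactly on the edges, such
that every vertex has finite total weight (so that the random walk on the graph is defined). -/
structure WeightedGraph (V : Type*) where
  graph : SimpleGraph V
  connected : graph.Connected
  w : V → V → ℝ
  w_symm : ∀ x y, w x y = w y x
  w_pos : ∀ x y, graph.Adj x y → 0 < w x y
  w_zero : ∀ x y, ¬ graph.Adj x y → w x y = 0
  w_summable : ∀ x, Summable (w x)

namespace WeightedGraph

variable {V : Type*} (Γ : WeightedGraph V)

/-- The measure of a vertex, `μ(x) = ∑_{y ∼ x} μ_{x,y}`. -/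
noncomputable def mu (x : V) : ℝ := ∑' y, Γ.w x y

/-- The transition probabilities `P(x,y) = μ_{x,y} / μ(x)`. -/
noncomputable def P (x y : V) : ℝ := Γ.w x y / Γ.mu x

/-- The Markov operator `Pf(x) = ∑_y P(x,y) f(y)`. -/
noncomputable def markov (f : V → ℝ) (x : V) : ℝ := ∑' y, Γ.P x y * f y

/-- The Laplace operator `Δ = P - I`. -/
noncomputable def laplace (f : V → ℝ) (x : V) : ℝ := Γ.markov f x - f x

/-- The inner product `(f,g)_μ = ∑_x f(x) g(x) μ(x)`; only used when one factor is finitely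
supported. -/
noncomputable def innerMu (f g : V → ℝ) : ℝ := ∑' x, f x * g x * Γ.mu x

/-- The open ball of real radius `R` for the shortest path distance. -/
def ball (x : V) (R : ℝ) : Set V := {y | (Γ.graph.dist x y : ℝ) < R}

/-- The set `A` together with all neighbours of its points. -/
def closure (A : Set V) : Set V := A ∪ {y | ∃ x ∈ A, Γ.graph.Adj x y}

/-- The resistance between two (disjoint) sets: the reciprocal of the infimum of `(-Δf, f)_μ` over
the finitely supported `f` with `f = 1` on `A` and `f = 0` on `B`, with `1/0 = ∞`. -/
noncomputable def resistance (A B : Set V) : ℝ≥0∞ :=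
  (⨅ f ∈ {f : V →₀ ℝ | (∀ a ∈ A, f a = 1) ∧ ∀ b ∈ B, f b = 0},
    ENNReal.ofReal (Γ.innerMu (fun x => - Γ.laplace f x) f))⁻¹

/-- The resistance of the annulus, `ρ(x,r,R) = ρ(B(x,r), Γ \ B(x,R))`. -/
noncomputable def rho (x : V) (r R : ℝ) : ℝ≥0∞ :=
  Γ.resistance (Γ.ball x r) (Γ.ball x R)ᶜ

/-- Condition (p₀), controlled weights. -/
def P0 : Prop := ∃ p₀ : ℝ, 0 < p₀ ∧ ∀ x y, Γ.graph.Adj x y → p₀ ≤ Γ.w x y / Γ.mu x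

/-- `h` is harmonic on `A`. Only the values of `h` on the closure of `A` matter. -/
def HarmonicOn (h : V → ℝ) (A : Set V) : Prop := ∀ x ∈ A, Γ.markov h x = h x

/-- The elliptic Harnack inequality: `max_{B(x,R)} u ≤ H min_{B(x,R)} u` whenever `u` is
non-negative (on the closure of `B(x,2R)`, its domain) and harmonic in `B(x,2R)`. -/
def Harnack : Prop :=
  ∃ H : ℝ, 1 < H ∧ ∀ (x : V) (R : ℝ), 0 < R → ∀ u : V → ℝ,
    (∀ y ∈ Γ.closure (Γ.ball x (2 * R)), 0 ≤ u y) → Γ.HarmonicOn u (Γ.ball x (2 * R)) →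
      ∀ y ∈ Γ.ball x R, ∀ z ∈ Γ.ball x R, u y ≤ H * u z

/-- The bounded covering condition: every ball `B(x,2R)` is covered by at most `K` balls of
radius `R`. -/
def BoundedCovering : Prop :=
  ∃ K : ℕ, ∀ (x : V) (R : ℝ), 0 < R →
    ∃ s : Finset V, s.card ≤ K ∧ Γ.ball x (2 * R) ⊆ ⋃ c ∈ s, Γ.ball c R

end WeightedGraph

/-! A resistance is the reciprocal of a capacity, so each inequality asks to turn any test function
of the left annulus into one of the right annulus at bounded cost in energy (`rho_le_mul`). At
bounded radius (p₀) compares the capacities with μ(x) (`exists_rho_le_mul_of_le`); the rest concerns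
large R.

Inner radius. Let g be the Green function of B(x,4R) with pole x, and m its minimum on the sphere of
radius about 2R. Harnack chains give g ≤ C m at distance about R/2, hence further out. Then
min(g,m)/m is a test function for radii 2R, 4R of energy at most 1/m, while Cauchy–Schwarz against
min(g,Cm) shows that test functions for R, 4R have energy at least 1/(Cm). Annuli may be
disconnected, so a chain can be forced towards the pole; the symmetry of g provides a detour
(`HarnackWith.three_point`).

Outer radius. Let E be the energy of a test function for R, 4R. By (BC), boundedly many balls of
radius R/64 cover B(x,R) and the sphere of radius about 2R; cut-offs between pairs of these balls
combine by minima and complements, so one of energy O(E) per pair suffices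
(`exists_isCutoff_balls`). Take the unit-charge equilibrium potentials of both balls in B(x,20R). If
one of them drops by δ throughout the other ball, its truncation is a cut-off of energy at most 1/δ.
If neither does, Harnack and the domination principle make the Green function of B(x,20R) exceed
some constant m by at most O(δ) at separated points well inside. A dipole of truncated Green
functions, with poles at x and at distance about 5R, then has energy O(δ) because m cancels, and
Cauchy–Schwarz gives E ≥ c/δ. This fails when δ is a small multiple of 1/E. -/

namespace WeightedGraph

variable {V : Type*} (Γ : WeightedGraph V)

/-! ### Graph distance and local finiteness -/

/-- The graph distance as a real number. -/
noncomputable def d (x y : V) : ℝ := (Γ.graph.dist x y : ℝ)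

lemma d_nonneg (x y : V) : 0 ≤ Γ.d x y := Nat.cast_nonneg _

lemma d_self (x : V) : Γ.d x x = 0 := by simp [d]

lemma d_comm (x y : V) : Γ.d x y = Γ.d y x := by simp [d, SimpleGraph.dist_comm]

lemma d_triangle (x y z : V) : Γ.d x z ≤ Γ.d x y + Γ.d y z := by
  unfold d; exact_mod_cast Γ.connected.dist_triangle

lemma eq_of_d_eq_zero {x y : V} (h : Γ.d x y = 0) : x = y := by
  unfold d at h
  exact Γ.connected.dist_eq_zero_iff.1 (by exact_mod_cast h)

lemma d_adj {y z : V} (h : Γ.graph.Adj y z) : Γ.d y z = 1 := by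
  unfold d; exact_mod_cast SimpleGraph.dist_eq_one_iff_adj.2 h

lemma d_le_of_adj (x : V) {y z : V} (h : Γ.graph.Adj y z) : Γ.d x z ≤ Γ.d x y + 1 := by
  have := Γ.d_triangle x y z
  rwa [Γ.d_adj h] at this

lemma mem_ball {x y : V} {R : ℝ} : y ∈ Γ.ball x R ↔ Γ.d x y < R := Iff.rfl

lemma d_of_mem_closure_ball {x y : V} {R : ℝ} (h : y ∈ Γ.closure (Γ.ball x R)) :
    Γ.d x y < R + 1 := by
  rcases h with h | ⟨z, hz, hzy⟩
  · have := Γ.mem_ball.1 h; linarith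
  · have := Γ.mem_ball.1 hz
    have := Γ.d_le_of_adj x hzy
    linarith

lemma exists_d_eq (x y : V) {k : ℕ} (hk : (k : ℝ) ≤ Γ.d x y) :
    ∃ z, Γ.d x z = k ∧ Γ.d z y = Γ.d x y - k := by
  obtain ⟨p, hp⟩ := Γ.connected.exists_walk_length_eq_dist x y
  have hk' : k ≤ p.length := by rw [hp]; unfold d at hk; exact_mod_cast hk
  have h1 := SimpleGraph.dist_le (p.take k)
  have h2 := SimpleGraph.dist_le (p.drop k)
  have h3 := Γ.d_triangle x (p.getVert k) y
  rw [SimpleGraph.Walk.take_length] at h1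
  rw [SimpleGraph.Walk.drop_length] at h2
  have h1' : Γ.d x (p.getVert k) ≤ k := by
    unfold d; exact_mod_cast h1.trans (min_le_left _ _)
  have h2' : Γ.d (p.getVert k) y ≤ Γ.d x y - k := by
    have : (Γ.graph.dist (p.getVert k) y : ℝ) ≤ ((p.length - k : ℕ) : ℝ) := by exact_mod_cast h2
    rw [Nat.cast_sub hk', hp] at this
    exact this
  exact ⟨p.getVert k, by linarith, by linarith⟩

/-- Every vertex has finitely many neighbours. -/
def LocFin : Prop := ∀ x, {y | Γ.graph.Adj x y}.Finite

variable {Γ}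

lemma exists_adj [Infinite V] (x : V) : ∃ y, Γ.graph.Adj x y := by
  obtain ⟨y, hy⟩ := exists_ne x
  have h : ((1 : ℕ) : ℝ) ≤ Γ.d x y := by
    unfold d
    exact_mod_cast Γ.connected.pos_dist_of_ne hy.symm
  obtain ⟨z, hz, -⟩ := Γ.exists_d_eq x y h
  refine ⟨z, ?_⟩
  unfold d at hz
  exact SimpleGraph.dist_eq_one_iff_adj.1 (by exact_mod_cast hz)

lemma w_nonneg (x y : V) : 0 ≤ Γ.w x y := by
  by_cases h : Γ.graph.Adj x y
  · exact (Γ.w_pos x y h).le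
  · exact (Γ.w_zero x y h).ge

lemma w_le_mu (x y : V) : Γ.w x y ≤ Γ.mu x :=
  (Γ.w_summable x).le_tsum y fun z _ => w_nonneg x z

lemma mu_pos [Infinite V] (x : V) : 0 < Γ.mu x := by
  obtain ⟨y, hy⟩ := exists_adj (Γ := Γ) x
  exact (Γ.w_pos x y hy).trans_le (w_le_mu x y)

/-- The weights at a vertex are summable, so only finitely many can reach p₀ μ(x). -/
lemma locFin_of_le [Infinite V] {p₀ : ℝ} (h0 : 0 < p₀)
    (hp : ∀ x y, Γ.graph.Adj x y → p₀ ≤ Γ.w x y / Γ.mu x) : Γ.LocFin := by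
  intro x
  have hs := (Γ.w_summable x).tendsto_cofinite_zero
  have := hs.eventually (gt_mem_nhds (mul_pos h0 (mu_pos (Γ := Γ) x)))
  refine (Filter.eventually_cofinite.1 this).subset fun y hy => ?_
  simp only [Set.mem_ofPred_eq, not_lt]
  exact (le_div_iff₀ (mu_pos x)).1 (hp x y hy)

lemma finite_le (hΓ : Γ.LocFin) (x : V) (n : ℕ) : {y | Γ.d x y ≤ n}.Finite := by
  induction n with
  | zero =>
    refine (Set.finite_singleton x).subset fun y hy => ?_
    have h : Γ.d x y ≤ (0 : ℕ) := hy
    exact (Γ.eq_of_d_eq_zero (le_antisymm (by simpa using h) (Γ.d_nonneg _ _))).symm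
  | succ n ih =>
    refine (ih.union (ih.biUnion fun y _ => hΓ y)).subset fun y hy => ?_
    by_cases h : Γ.d x y ≤ n
    · exact Or.inl h
    · right
      push Not at h
      obtain ⟨z, hz, hzy⟩ := Γ.exists_d_eq x y h.le
      simp only [Set.mem_iUnion]
      refine ⟨z, hz.le, ?_⟩
      have h' : Γ.d x y ≤ ((n + 1 : ℕ) : ℝ) := hy
      have h1 : Γ.d z y ≤ 1 := by push_cast at h'; linarith
      have h2 : Γ.d z y ≠ 0 := by rw [hzy]; linarith
      unfold d at h1 h2
      refine SimpleGraph.dist_eq_one_iff_adj.1 ?_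
      have h1' : Γ.graph.dist z y ≤ 1 := by exact_mod_cast h1
      have h2' : Γ.graph.dist z y ≠ 0 := by exact_mod_cast h2
      omega

lemma finite_ball (hΓ : Γ.LocFin) (x : V) (R : ℝ) : (Γ.ball x R).Finite :=
  (finite_le hΓ x ⌈R⌉₊).subset fun _ hy => (Γ.mem_ball.1 hy).le.trans (Nat.le_ceil R)

lemma exists_sphere [Infinite V] (hΓ : Γ.LocFin) (x : V) (n : ℕ) : ∃ y, Γ.d x y = n := by
  obtain ⟨y, hy⟩ := (finite_le hΓ x n).exists_notMem
  have hy' : (n : ℝ) ≤ Γ.d x y := by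
    have : ¬ (Γ.d x y ≤ n) := hy
    exact (not_le.1 this).le
  obtain ⟨z, hz, -⟩ := Γ.exists_d_eq x y hy'
  exact ⟨z, hz⟩

/-! ### Laplacian, Dirichlet form and Green's formula -/

variable (Γ)

/-- The unnormalised positive Laplace operator `∑_y μ_{x,y} (f(x) - f(y)) = - μ(x) Δf(x)`. -/
noncomputable def lap (f : V → ℝ) (x : V) : ℝ := ∑' y, Γ.w x y * (f x - f y)

/-- Twice the Dirichlet form of the network induced on the finite set `F`. -/
noncomputable def form (F : Finset V) (f g : V → ℝ) : ℝ :=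
  ∑ x ∈ F, ∑ y ∈ F, Γ.w x y * ((f x - f y) * (g x - g y))

variable {Γ}

lemma tsum_eq_of_nbrs {F : Finset V} {x : V} (hF : ∀ y, Γ.graph.Adj x y → y ∈ F) (h : V → ℝ) :
    ∑' y, Γ.w x y * h y = ∑ y ∈ F, Γ.w x y * h y :=
  tsum_eq_sum fun y hy => by rw [Γ.w_zero x y fun h => hy (hF y h), zero_mul]

lemma lap_eq_sum {F : Finset V} {x : V} (hF : ∀ y, Γ.graph.Adj x y → y ∈ F) (f : V → ℝ) :
    Γ.lap f x = ∑ y ∈ F, Γ.w x y * (f x - f y) :=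
  tsum_eq_of_nbrs hF fun y => f x - f y

lemma LocFin.nbrs (hΓ : Γ.LocFin) (x : V) : ∀ y, Γ.graph.Adj x y → y ∈ (hΓ x).toFinset := by
  simp

lemma lap_add (hΓ : Γ.LocFin) (f g : V → ℝ) (x : V) :
    Γ.lap (fun y => f y + g y) x = Γ.lap f x + Γ.lap g x := by
  simp only [lap_eq_sum (hΓ.nbrs x), ← Finset.sum_add_distrib]
  exact Finset.sum_congr rfl fun y _ => by ring

lemma lap_sub (hΓ : Γ.LocFin) (f g : V → ℝ) (x : V) :
    Γ.lap (fun y => f y - g y) x = Γ.lap f x - Γ.lap g x := by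
  simp only [lap_eq_sum (hΓ.nbrs x), ← Finset.sum_sub_distrib]
  exact Finset.sum_congr rfl fun y _ => by ring

lemma lap_const_mul (hΓ : Γ.LocFin) (c : ℝ) (f : V → ℝ) (x : V) :
    Γ.lap (fun y => c * f y) x = c * Γ.lap f x := by
  simp only [lap_eq_sum (hΓ.nbrs x), Finset.mul_sum]
  exact Finset.sum_congr rfl fun y _ => by ring

lemma lap_sub_const (f : V → ℝ) (c : ℝ) (x : V) :
    Γ.lap (fun y => f y - c) x = Γ.lap f x := by
  simp [lap]

lemma lap_const_sub (hΓ : Γ.LocFin) (f : V → ℝ) (c : ℝ) (x : V) :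
    Γ.lap (fun y => c - f y) x = - Γ.lap f x := by
  simp only [lap_eq_sum (hΓ.nbrs x), ← Finset.sum_neg_distrib]
  exact Finset.sum_congr rfl fun y _ => by ring

lemma lap_eq (hΓ : Γ.LocFin) [Infinite V] (f : V → ℝ) (x : V) :
    Γ.lap f x = Γ.mu x * (- Γ.laplace f x) := by
  have hμ := (mu_pos (Γ := Γ) x).ne'
  have h1 : Γ.mu x = ∑ y ∈ (hΓ x).toFinset, Γ.w x y := by
    have := tsum_eq_of_nbrs (hΓ.nbrs x) fun _ => (1 : ℝ)
    simpa [mu] using this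
  have h2 : Γ.markov f x = (∑ y ∈ (hΓ x).toFinset, Γ.w x y * f y) / Γ.mu x := by
    unfold markov P
    rw [← tsum_eq_of_nbrs (hΓ.nbrs x) f, ← tsum_div_const]
    exact tsum_congr fun y => by ring
  have h3 : Γ.lap f x = Γ.mu x * f x - ∑ y ∈ (hΓ x).toFinset, Γ.w x y * f y := by
    rw [lap_eq_sum (hΓ.nbrs x), h1, Finset.sum_mul, ← Finset.sum_sub_distrib]
    exact Finset.sum_congr rfl fun y _ => by ring
  rw [h3, laplace, h2]
  field_simp
  ring

lemma markov_eq_iff (hΓ : Γ.LocFin) [Infinite V] (f : V → ℝ) (x : V) :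
    Γ.markov f x = f x ↔ Γ.lap f x = 0 := by
  rw [lap_eq hΓ, laplace, mul_eq_zero, or_iff_right (mu_pos x).ne', neg_eq_zero, sub_eq_zero]

lemma form_comm (F : Finset V) (f g : V → ℝ) : Γ.form F f g = Γ.form F g f := by
  unfold form
  exact Finset.sum_congr rfl fun x _ => Finset.sum_congr rfl fun y _ => by ring

lemma form_eq_sum (F : Finset V) (f g : V → ℝ) :
    Γ.form F f g = 2 * ∑ x ∈ F, f x * ∑ y ∈ F, Γ.w x y * (g x - g y) := by
  have h1 : Γ.form F f g = ∑ x ∈ F, ∑ y ∈ F, f x * (Γ.w x y * (g x - g y)) -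
      ∑ x ∈ F, ∑ y ∈ F, f y * (Γ.w x y * (g x - g y)) := by
    unfold form
    rw [← Finset.sum_sub_distrib]
    refine Finset.sum_congr rfl fun x _ => ?_
    rw [← Finset.sum_sub_distrib]
    exact Finset.sum_congr rfl fun y _ => by ring
  have h2 : ∑ x ∈ F, ∑ y ∈ F, f y * (Γ.w x y * (g x - g y)) =
      - ∑ x ∈ F, ∑ y ∈ F, f x * (Γ.w x y * (g x - g y)) := by
    rw [Finset.sum_comm, ← Finset.sum_neg_distrib]
    refine Finset.sum_congr rfl fun x _ => ?_
    rw [← Finset.sum_neg_distrib]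
    refine Finset.sum_congr rfl fun y _ => ?_
    rw [Γ.w_symm y x]; ring
  rw [h1, h2]
  simp only [Finset.mul_sum]
  rw [sub_neg_eq_add, ← two_mul, Finset.mul_sum]
  simp only [Finset.mul_sum]

/-- Green's formula for `f` vanishing off `D`. -/
lemma form_eq_sum_lap {F : Finset V} {D : Set V} (hF : Γ.closure D ⊆ F) {f : V → ℝ}
    (hf : ∀ x ∉ D, f x = 0) (g : V → ℝ) :
    Γ.form F f g = 2 * ∑ x ∈ F, f x * Γ.lap g x := by
  rw [form_eq_sum]
  congr 1
  refine Finset.sum_congr rfl fun x _ => ?_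
  by_cases hx : x ∈ D
  · rw [lap_eq_sum fun y hy => hF (Or.inr ⟨x, hx, hy⟩)]
  · rw [hf x hx, zero_mul, zero_mul]

lemma form_self_nonneg (F : Finset V) (f : V → ℝ) : 0 ≤ Γ.form F f f :=
  Finset.sum_nonneg fun x _ => Finset.sum_nonneg fun y _ =>
    mul_nonneg (w_nonneg x y) (mul_self_nonneg _)

lemma form_le_form {F : Finset V} {f g f' g' : V → ℝ}
    (h : ∀ x y, (f x - f y) * (g x - g y) ≤ (f' x - f' y) * (g' x - g' y)) :
    Γ.form F f g ≤ Γ.form F f' g' :=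
  Finset.sum_le_sum fun x _ => Finset.sum_le_sum fun y _ =>
    mul_le_mul_of_nonneg_left (h x y) (w_nonneg x y)

lemma form_const_mul_self (F : Finset V) (c : ℝ) (f : V → ℝ) :
    Γ.form F (fun x => c * f x) (fun x => c * f x) = c ^ 2 * Γ.form F f f := by
  simp only [form, Finset.mul_sum]
  exact Finset.sum_congr rfl fun x _ => Finset.sum_congr rfl fun y _ => by ring

lemma form_sub_right (F : Finset V) (f g h : V → ℝ) :
    Γ.form F f (fun x => g x - h x) = Γ.form F f g - Γ.form F f h := by
  simp only [form, ← Finset.sum_sub_distrib]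
  exact Finset.sum_congr rfl fun x _ => Finset.sum_congr rfl fun y _ => by ring

lemma form_cauchy_schwarz (F : Finset V) (f g : V → ℝ) :
    Γ.form F f g ^ 2 ≤ Γ.form F f f * Γ.form F g g := by
  unfold form
  simp only [← Finset.sum_product']
  refine Finset.sum_sq_le_sum_mul_sum_of_sq_le_mul _
    (fun p _ => mul_nonneg (w_nonneg _ _) (mul_self_nonneg _))
    (fun p _ => mul_nonneg (w_nonneg _ _) (mul_self_nonneg _)) fun p _ => le_of_eq (by ring)

lemma innerMu_eq_form (hΓ : Γ.LocFin) [Infinite V] {F : Finset V} {D : Set V}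
    (hF : Γ.closure D ⊆ F) {f : V → ℝ} (hf : ∀ x ∉ D, f x = 0) :
    Γ.innerMu (fun x => - Γ.laplace f x) f = Γ.form F f f / 2 := by
  rw [form_eq_sum_lap hF hf, mul_div_cancel_left₀ _ two_ne_zero, innerMu, tsum_eq_sum (s := F)]
  · exact Finset.sum_congr rfl fun x _ => by rw [lap_eq hΓ]; ring
  · intro x hx
    rw [hf x fun h => hx (hF (Or.inl h))]; ring

/-! ### Minimum principle and Dirichlet problem -/

/-- The minimum principle for superharmonic functions on a finite set. -/
lemma nonneg_of_superharmonic [Infinite V] (hΓ : Γ.LocFin) {W : Set V} (hW : W.Finite)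
    {u : V → ℝ} (hu : ∀ x ∈ W, 0 ≤ Γ.lap u x)
    (hb : ∀ x ∈ W, ∀ y, Γ.graph.Adj x y → y ∉ W → 0 ≤ u y) : ∀ x ∈ W, 0 ≤ u x := by
  intro x hx
  obtain ⟨p, hp, hmin⟩ := W.exists_min_image u hW ⟨x, hx⟩
  by_contra! hneg
  have hpneg : u p < 0 := (hmin x hx).trans_lt hneg
  -- A negative minimum propagates to every neighbour, hence along every walk; by connectedness W
  -- would be the whole infinite graph.
  have key : ∀ q, Γ.graph.Reachable p q → q ∈ W ∧ u q = u p := by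
    rintro q ⟨c⟩
    induction c using SimpleGraph.Walk.concatRec with
    | Hnil => exact ⟨hp, rfl⟩
    | Hconcat c h ih =>
      rename_i a y q
      obtain ⟨hq, hqu⟩ := ih hp hmin hpneg
      have hle : ∀ z, Γ.graph.Adj y z → u y ≤ u z := by
        intro z hz
        by_cases hzW : z ∈ W
        · rw [hqu]; exact hmin z hzW
        · exact le_trans (by rw [hqu]; exact hpneg.le) (hb y hq z hz hzW)
      have hl := hu y hq
      rw [lap_eq_sum (hΓ.nbrs y)] at hl
      have hterm : ∀ z ∈ (hΓ y).toFinset, Γ.w y z * (u y - u z) ≤ 0 := fun z hz =>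
        mul_nonpos_of_nonneg_of_nonpos (w_nonneg _ _)
          (sub_nonpos.2 (hle z (by simpa using hz)))
      have h0 := (Finset.sum_eq_zero_iff_of_nonpos hterm).1
        (le_antisymm (Finset.sum_nonpos hterm) hl) q (hΓ.nbrs y q h)
      have heq : u q = u a := by
        rcases mul_eq_zero.1 h0 with h0 | h0
        · exact absurd h0 (Γ.w_pos _ _ h).ne'
        · linarith
      refine ⟨?_, heq⟩
      by_contra hqW
      have := hb y hq q h hqW
      rw [heq] at this
      linarith
  exact hW.infinite_compl.nonempty.elim fun y hy => hy (key y (Γ.connected.preconnected p y)).1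

/-- The Dirichlet problem on a finite set. -/
lemma exists_dirichlet [Infinite V] (hΓ : Γ.LocFin) {W : Set V} (hW : W.Finite) (φ ψ : V → ℝ) :
    ∃ u : V → ℝ, (∀ x ∉ W, u x = φ x) ∧ ∀ x ∈ W, Γ.lap u x = ψ x := by
  classical
  have : Fintype W := hW.fintype
  let ext : (W → ℝ) → V → ℝ := fun v x => if h : x ∈ W then v ⟨x, h⟩ else 0
  have ext_add : ∀ v v', ext (v + v') = fun x => ext v x + ext v' x := by
    intro v v'; funext x; by_cases h : x ∈ W <;> simp [ext, h]
  have ext_smul : ∀ (c : ℝ) v, ext (c • v) = fun x => c * ext v x := by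
    intro c v; funext x; by_cases h : x ∈ W <;> simp [ext, h]
  let T : (W → ℝ) →ₗ[ℝ] (W → ℝ) :=
    { toFun := fun v x => Γ.lap (ext v) x
      map_add' := fun v v' => by funext x; rw [ext_add]; exact lap_add hΓ _ _ _
      map_smul' := fun c v => by funext x; rw [ext_smul]; exact lap_const_mul hΓ _ _ _ }
  -- The minimum principle for v and -v gives uniqueness; existence follows by finite dimension.
  have hinj : Function.Injective T := by
    rw [← LinearMap.ker_eq_bot, LinearMap.ker_eq_bot']
    intro v hv
    have hv' : ∀ x ∈ W, Γ.lap (ext v) x = 0 := fun x hx => congrFun hv ⟨x, hx⟩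
    have h1 := nonneg_of_superharmonic hΓ hW (u := ext v) (fun x hx => (hv' x hx).ge)
      (fun x _ y _ hy => by simp [ext, hy])
    have h2 := nonneg_of_superharmonic hΓ hW (u := fun x => 0 - ext v x)
      (fun x hx => by rw [lap_const_sub hΓ, hv' x hx, neg_zero])
      (fun x _ y _ hy => by simp [ext, hy])
    funext ⟨x, hx⟩
    have h1 := h1 x hx
    have h2 := h2 x hx
    simp only [ext, hx, dif_pos] at h1 h2
    simp only [Pi.zero_apply]
    linarith
  have hsurj := LinearMap.injective_iff_surjective.1 hinj
  let φ' : V → ℝ := fun x => if x ∈ W then 0 else φ x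
  obtain ⟨v, hv⟩ := hsurj fun x => ψ x - Γ.lap φ' x
  refine ⟨fun x => ext v x + φ' x, fun x hx => by simp [ext, φ', hx], fun x hx => ?_⟩
  rw [lap_add hΓ]
  have : Γ.lap (ext v) x = ψ x - Γ.lap φ' x := congrFun hv ⟨x, hx⟩
  linarith

/-! ### Comparing resistances through test functions -/

/-- Passing to reciprocals reverses the inequality: test functions of the pair on the left are
given, and those of the pair on the right are to be built. -/
lemma resistance_le_mul {A B A' B' : Set V} {C : ℝ≥0} (hC : 0 < C)
    (h : ∀ f : V →₀ ℝ, (∀ a ∈ A, f a = 1) → (∀ b ∈ B, f b = 0) →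
      ∃ f' : V →₀ ℝ, (∀ a ∈ A', f' a = 1) ∧ (∀ b ∈ B', f' b = 0) ∧
        Γ.innerMu (fun x => - Γ.laplace f' x) f' ≤ C * Γ.innerMu (fun x => - Γ.laplace f x) f) :
    Γ.resistance A B ≤ C * Γ.resistance A' B' := by
  have hC0 : (C : ℝ≥0∞) ≠ 0 := by exact_mod_cast hC.ne'
  unfold resistance
  rw [← ENNReal.inv_le_inv, inv_inv, ENNReal.mul_inv (Or.inl hC0) (Or.inl ENNReal.coe_ne_top),
    inv_inv, mul_comm, ← div_eq_mul_inv, ENNReal.div_le_iff hC0 ENNReal.coe_ne_top, mul_comm]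
  rw [ENNReal.mul_iInf_of_ne hC0 ENNReal.coe_ne_top]
  refine le_iInf fun f => ?_
  rw [ENNReal.mul_iInf_of_ne hC0 ENNReal.coe_ne_top]
  refine le_iInf fun hf => ?_
  obtain ⟨f', h1, h2, h3⟩ := h f hf.1 hf.2
  refine (iInf₂_le f' ⟨h1, h2⟩).trans ?_
  rw [← ENNReal.ofReal_coe_nnreal, ← ENNReal.ofReal_mul C.coe_nonneg]
  exact ENNReal.ofReal_le_ofReal h3

lemma LocFin.finite_closure (hΓ : Γ.LocFin) {D : Set V} (hD : D.Finite) :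
    (Γ.closure D).Finite := by
  refine hD.union ((hD.biUnion fun y _ => hΓ y).subset ?_)
  rintro y ⟨x, hx, hxy⟩
  simp only [Set.mem_iUnion]
  exact ⟨x, hx, hxy⟩

lemma rho_le_mul (hΓ : Γ.LocFin) [Infinite V] {x : V} {r R r' R' : ℝ} {F : Finset V}
    (hF : Γ.closure (Γ.ball x R) ⊆ F) (hF' : Γ.closure (Γ.ball x R') ⊆ F) {C : ℝ≥0} (hC : 0 < C)
    (h : ∀ f : V → ℝ, (∀ y, Γ.d x y < r → f y = 1) → (∀ y, R ≤ Γ.d x y → f y = 0) →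
      ∃ f' : V → ℝ, (∀ y, Γ.d x y < r' → f' y = 1) ∧ (∀ y, R' ≤ Γ.d x y → f' y = 0) ∧
        Γ.form F f' f' ≤ C * Γ.form F f f) :
    Γ.rho x r R ≤ C * Γ.rho x r' R' := by
  refine resistance_le_mul hC fun f h1 h2 => ?_
  have h2' : ∀ y, R ≤ Γ.d x y → f y = 0 := fun y hy => h2 y fun h => not_lt.2 hy h
  obtain ⟨f', h3, h4, h5⟩ := h f (fun y hy => h1 y hy) h2'
  have hs : (Function.support f').Finite :=
    (finite_ball hΓ x R').subset fun y hy => by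
      by_contra hn
      exact hy (h4 y (not_lt.1 fun h => hn h))
  refine ⟨Finsupp.ofSupportFinite f' hs, fun a ha => h3 a ha, fun b hb => ?_, ?_⟩
  · exact h4 b (not_lt.1 fun h => hb h)
  · have e1 : Γ.innerMu (fun x => - Γ.laplace f' x) f' = Γ.form F f' f' / 2 :=
      innerMu_eq_form hΓ hF' fun y hy => h4 y (not_lt.1 fun h => hy h)
    have e2 : Γ.innerMu (fun x => - Γ.laplace f x) f = Γ.form F f f / 2 :=
      innerMu_eq_form hΓ hF fun y hy => h2' y (not_lt.1 fun h => hy h)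
    change Γ.innerMu (fun x => - Γ.laplace f' x) f' ≤ _
    rw [e1, e2]
    linarith

/-- Typically h is the excess of a Green function over a truncation level, supported where f is
constant. -/
lemma form_eq_zero_of_const {F : Finset V} {f h : V → ℝ}
    (hfh : ∀ y z, Γ.graph.Adj y z → h y ≠ 0 → f y = f z) : Γ.form F f h = 0 := by
  refine Finset.sum_eq_zero fun y _ => Finset.sum_eq_zero fun z _ => ?_
  by_cases hyz : Γ.graph.Adj y z
  · by_cases h1 : h y = 0
    · by_cases h2 : h z = 0
      · rw [h1, h2]; ring
      · rw [hfh z y hyz.symm h2]; ring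
    · rw [hfh y z hyz h1]; ring
  · rw [Γ.w_zero y z hyz, zero_mul]

/-! ### Green functions and equilibrium potentials -/

variable (Γ)

/-- `g` is the Green function of the walk killed on leaving `D` (normalised by `μ`). -/
structure IsGreen (D : Set V) (g : V → V → ℝ) : Prop where
  symm : ∀ p q, g p q = g q p
  nonneg : ∀ p q, 0 ≤ g p q
  zero : ∀ p q, q ∉ D → g p q = 0
  lap_self : ∀ p ∈ D, Γ.lap (g p) p = 1
  lap_ne : ∀ p, ∀ q ∈ D, q ≠ p → Γ.lap (g p) q = 0

variable {Γ}

lemma IsGreen.lap_nonneg {D : Set V} {g : V → V → ℝ} (hg : Γ.IsGreen D g) (p : V) {q : V}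
    (hq : q ∈ D) : 0 ≤ Γ.lap (g p) q := by
  by_cases h : q = p
  · subst h; rw [hg.lap_self q hq]; exact zero_le_one
  · exact (hg.lap_ne p q hq h).ge

/-- Reproducing property: in Green's formula only the pole contributes. The factor 2 comes from
`form` counting each edge twice. -/
lemma IsGreen.form_eq {D : Set V} {g : V → V → ℝ} (hg : Γ.IsGreen D g) {F : Finset V}
    (hF : Γ.closure D ⊆ F) {f : V → ℝ} (hf : ∀ x ∉ D, f x = 0) {p : V} (hp : p ∈ D) :
    Γ.form F f (g p) = 2 * f p := by
  rw [form_eq_sum_lap hF hf, Finset.sum_eq_single p, hg.lap_self p hp, mul_one]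
  · intro q _ hqp
    by_cases hq : q ∈ D
    · rw [hg.lap_ne p q hq hqp, mul_zero]
    · rw [hf q hq, zero_mul]
  · intro h; exact absurd (hF (Or.inl hp)) h

lemma exists_isGreen [Infinite V] (hΓ : Γ.LocFin) {D : Set V} (hD : D.Finite) :
    ∃ g, Γ.IsGreen D g := by
  classical
  choose g hg0 hg1 using fun p : V =>
    exists_dirichlet hΓ hD (fun _ => 0) (fun q => if q = p then 1 else 0)
  have hcl := hΓ.finite_closure hD
  have key : ∀ p ∈ D, ∀ f : V → ℝ, (∀ x ∉ D, f x = 0) →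
      Γ.form hcl.toFinset f (g p) = 2 * f p := by
    intro p hp f hf
    rw [form_eq_sum_lap (by simp) hf, Finset.sum_eq_single p, hg1 p p hp]
    · simp
    · intro q _ hqp
      by_cases hq : q ∈ D
      · rw [hg1 p q hq, if_neg hqp, mul_zero]
      · rw [hf q hq, zero_mul]
    · intro h; exact absurd (hcl.mem_toFinset.2 (Or.inl hp)) h
  have hnn : ∀ p q, 0 ≤ g p q := by
    intro p q
    by_cases hq : q ∈ D
    · refine nonneg_of_superharmonic hΓ hD (fun x hx => ?_) (fun _ _ y _ hy => (hg0 p y hy).ge) q hq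
      rw [hg1 p x hx]; split_ifs <;> norm_num
    · exact (hg0 p q hq).ge
  -- With its pole outside D the function is harmonic with zero boundary values; this makes symmetry
  -- hold for all pairs.
  have hout : ∀ p ∉ D, ∀ q, g p q = 0 := by
    intro p hp q
    by_cases hq : q ∈ D
    · have := nonneg_of_superharmonic hΓ hD (u := fun y => 0 - g p y) (fun x hx => by
        rw [lap_const_sub hΓ, hg1 p x hx, if_neg fun h => hp (by rw [← h]; exact hx), neg_zero])
        (fun _ _ y _ hy => by simp [hg0 p y hy]) q hq
      have h2 := hnn p q
      linarith
    · exact hg0 p q hq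
  refine ⟨g, ⟨fun p q => ?_, hnn, hg0, fun p hp => by rw [hg1 p p hp, if_pos rfl],
    fun p q hq hqp => by rw [hg1 p q hq, if_neg hqp]⟩⟩
  by_cases hp : p ∈ D
  · by_cases hq : q ∈ D
    · have h1 := key p hp (g q) (hg0 q)
      have h2 := key q hq (g p) (hg0 p)
      rw [form_comm] at h1
      linarith
    · rw [hg0 p q hq, hout q hq]
  · rw [hg0 q p hp, hout p hp]

variable (Γ)

/-- `e` is the equilibrium potential of `A` in `D`, normalised to have unit charge; `M` is its value
on `A`, the resistance between `A` and the complement of `D`. -/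
structure IsEquilibrium (D : Set V) (A : Finset V) (e : V → ℝ) (M : ℝ) : Prop where
  pos : 0 < M
  subset : (A : Set V) ⊆ D
  eq : ∀ a ∈ A, e a = M
  nonneg : ∀ x, 0 ≤ e x
  le : ∀ x, e x ≤ M
  zero : ∀ x ∉ D, e x = 0
  lap_zero : ∀ x ∈ D, x ∉ A → Γ.lap e x = 0
  lap_nonneg : ∀ a ∈ A, 0 ≤ Γ.lap e a
  charge : ∑ a ∈ A, Γ.lap e a = 1

variable {Γ}

namespace IsEquilibrium

variable {D : Set V} {A : Finset V} {e : V → ℝ} {M : ℝ}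

lemma superharmonic (he : Γ.IsEquilibrium D A e M) {x : V} (hx : x ∈ D) : 0 ≤ Γ.lap e x := by
  by_cases h : x ∈ A
  · exact he.lap_nonneg x h
  · exact (he.lap_zero x hx h).ge

lemma form_eq (he : Γ.IsEquilibrium D A e M) {F : Finset V} (hF : Γ.closure D ⊆ F) {h : V → ℝ}
    (hh : ∀ x ∉ D, h x = 0) : Γ.form F h e = 2 * ∑ a ∈ A, Γ.lap e a * h a := by
  rw [form_eq_sum_lap hF hh]
  congr 1
  have hAF : A ⊆ F := fun a ha => hF (Or.inl (he.subset ha))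
  rw [← Finset.sum_subset hAF]
  · exact Finset.sum_congr rfl fun _ _ => mul_comm _ _
  · intro x _ hx
    by_cases hxD : x ∈ D
    · rw [he.lap_zero x hxD hx, mul_zero]
    · rw [hh x hxD, zero_mul]

/-- The charge `lap e` on A generates e, so averaging the Green function over it returns the
potential. -/
lemma sum_green (he : Γ.IsEquilibrium D A e M) {F : Finset V} (hF : Γ.closure D ⊆ F)
    {g : V → V → ℝ} (hg : Γ.IsGreen D g) {q : V} (hq : q ∈ D) :
    ∑ a ∈ A, Γ.lap e a * g q a = e q := by
  have h1 := he.form_eq hF (hg.zero q)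
  have h2 := hg.form_eq hF he.zero hq
  rw [form_comm] at h2
  linarith

/-- Both sides are half the mutual energy of the two potentials. -/
lemma sum_comm {A' : Finset V} {e' : V → ℝ} {M' : ℝ} (he : Γ.IsEquilibrium D A e M)
    (he' : Γ.IsEquilibrium D A' e' M') {F : Finset V} (hF : Γ.closure D ⊆ F) :
    ∑ a ∈ A, Γ.lap e a * e' a = ∑ a ∈ A', Γ.lap e' a * e a := by
  have h1 := he.form_eq hF he'.zero
  have h2 := he'.form_eq hF he.zero
  rw [form_comm] at h2
  linarith

lemma sum_le (he : Γ.IsEquilibrium D A e M) {h : V → ℝ} {c : ℝ} (hc : ∀ a ∈ A, h a ≤ c) :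
    ∑ a ∈ A, Γ.lap e a * h a ≤ c := by
  calc _ ≤ ∑ a ∈ A, Γ.lap e a * c :=
        Finset.sum_le_sum fun a ha => mul_le_mul_of_nonneg_left (hc a ha) (he.lap_nonneg a ha)
    _ = c := by rw [← Finset.sum_mul, he.charge, one_mul]

lemma le_sum (he : Γ.IsEquilibrium D A e M) {h : V → ℝ} {c : ℝ} (hc : ∀ a ∈ A, c ≤ h a) :
    c ≤ ∑ a ∈ A, Γ.lap e a * h a := by
  calc c = ∑ a ∈ A, Γ.lap e a * c := by rw [← Finset.sum_mul, he.charge, one_mul]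
    _ ≤ _ := Finset.sum_le_sum fun a ha => mul_le_mul_of_nonneg_left (hc a ha) (he.lap_nonneg a ha)

/-- Domination principle. -/
lemma mul_le [Infinite V] (hΓ : Γ.LocFin) (hD : D.Finite) (he : Γ.IsEquilibrium D A e M)
    {v : V → ℝ} (hv0 : ∀ x, 0 ≤ v x) (hv : ∀ x ∈ D, 0 ≤ Γ.lap v x) {γ : ℝ}
    (hγ : ∀ a ∈ A, γ ≤ v a) (p : V) : γ / M * e p ≤ v p := by
  have hA : ∀ a ∈ A, 0 ≤ v a - γ / M * e a := by
    intro a ha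
    rw [he.eq a ha, div_mul_cancel₀ _ he.pos.ne']
    linarith [hγ a ha]
  have hDc : ∀ y ∉ D, 0 ≤ v y - γ / M * e y := by
    intro y hy
    rw [he.zero y hy, mul_zero, sub_zero]
    exact hv0 y
  by_cases hpD : p ∈ D
  · by_cases hpA : p ∈ A
    · linarith [hA p hpA]
    · have := nonneg_of_superharmonic hΓ (W := D \ A) (hD.subset Set.sdiff_subset)
        (u := fun x => v x - γ / M * e x) (fun x hx => by
          rw [lap_sub hΓ, lap_const_mul hΓ, he.lap_zero x hx.1 hx.2, mul_zero, sub_zero]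
          exact hv x hx.1)
        (fun x _ y _ hy => by
          by_cases hyD : y ∈ D
          · exact hA y (by_contra fun h => hy ⟨hyD, h⟩)
          · exact hDc y hyD) p ⟨hpD, hpA⟩
      linarith
  · linarith [hDc p hpD]

end IsEquilibrium

lemma exists_isEquilibrium [Infinite V] (hΓ : Γ.LocFin) {D : Set V} (hD : D.Finite)
    {A : Finset V} (hA : A.Nonempty) (hAD : (A : Set V) ⊆ D) :
    ∃ e M, Γ.IsEquilibrium D A e M := by
  classical
  have hW : (D \ A).Finite := hD.subset Set.sdiff_subset
  obtain ⟨f, hf0, hf1⟩ := exists_dirichlet hΓ hW (fun x => if x ∈ A then 1 else 0) (fun _ => 0)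
  have hfA : ∀ a ∈ A, f a = 1 := fun a ha => by rw [hf0 a (fun h => h.2 ha), if_pos ha]
  have hfD : ∀ y ∉ D, f y = 0 := fun y hy => by
    rw [hf0 y (fun h => hy h.1), if_neg fun h : y ∈ A => hy (hAD h)]
  have hfn : ∀ x, 0 ≤ f x := by
    intro x
    by_cases hx : x ∈ D \ A
    · refine nonneg_of_superharmonic hΓ hW (fun x hx => (hf1 x hx).ge) (fun _ _ y _ hy => ?_) x hx
      rw [hf0 y hy]; split_ifs <;> norm_num
    · rw [hf0 x hx]; split_ifs <;> norm_num
  have hf_le : ∀ x, f x ≤ 1 := by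
    intro x
    by_cases hx : x ∈ D \ A
    · have := nonneg_of_superharmonic hΓ hW (u := fun y => 1 - f y)
        (fun x hx => by rw [lap_const_sub hΓ, hf1 x hx, neg_zero]) (fun _ _ y _ hy => by
          rw [hf0 y hy]; split_ifs <;> norm_num) x hx
      linarith
    · rw [hf0 x hx]; split_ifs <;> norm_num
  have hlap : ∀ a ∈ A, 0 ≤ Γ.lap f a := by
    intro a ha
    rw [lap_eq_sum (hΓ.nbrs a)]
    refine Finset.sum_nonneg fun y _ => mul_nonneg (w_nonneg _ _) ?_
    rw [hfA a ha]
    linarith [hf_le y]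
  obtain ⟨g, hg⟩ := exists_isGreen hΓ hD
  have hcl := hΓ.finite_closure hD
  set c := ∑ a ∈ A, Γ.lap f a with hc
  -- With zero total charge f would be harmonic on all of D, and pairing it with the Green function
  -- at a ∈ A would give f a = 0.
  have hcpos : 0 < c := by
    refine lt_of_le_of_ne (Finset.sum_nonneg hlap) fun h0 => ?_
    have hz := (Finset.sum_eq_zero_iff_of_nonneg hlap).1 h0.symm
    obtain ⟨a, ha⟩ := hA
    have h1 := hg.form_eq (F := hcl.toFinset) (by simp) hfD (hAD ha)
    rw [form_comm, form_eq_sum_lap (by simp) (hg.zero a), hfA a ha,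
      Finset.sum_eq_zero] at h1
    · norm_num at h1
    · intro x _
      by_cases hxD : x ∈ D
      · by_cases hxA : x ∈ A
        · rw [hz x hxA, mul_zero]
        · rw [hf1 x ⟨hxD, hxA⟩, mul_zero]
      · rw [hg.zero a x hxD, zero_mul]
  refine ⟨fun x => c⁻¹ * f x, c⁻¹, inv_pos.2 hcpos, hAD, fun a ha => by rw [hfA a ha, mul_one],
    fun x => mul_nonneg (inv_pos.2 hcpos).le (hfn x),
    fun x => mul_le_of_le_one_right (inv_pos.2 hcpos).le (hf_le x),
    fun x hx => by rw [hfD x hx, mul_zero],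
    fun x hx hxA => by rw [lap_const_mul hΓ, hf1 x ⟨hx, hxA⟩, mul_zero],
    fun a ha => ?_, ?_⟩
  · rw [lap_const_mul hΓ]
    exact mul_nonneg (inv_pos.2 hcpos).le (hlap a ha)
  · simp only [lap_const_mul hΓ]
    rw [← Finset.mul_sum, ← hc, inv_mul_cancel₀ hcpos.ne']

/-! ### Energy bounds from truncated Green functions -/

/-- The part of the Green function above T does not interact with f, so truncation preserves the
reproducing property. -/
lemma IsGreen.form_truncate_right {D : Set V} {g : V → V → ℝ} (hg : Γ.IsGreen D g) {F : Finset V}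
    (hF : Γ.closure D ⊆ F) {f : V → ℝ} (hf : ∀ x ∉ D, f x = 0) {p : V} (hp : p ∈ D) {T : ℝ}
    (h : ∀ y z, Γ.graph.Adj y z → T < g p y → f y = f z) :
    Γ.form F f (fun y => min (g p y) T) = 2 * f p := by
  have e : (fun y => min (g p y) T) = fun y => g p y - max (g p y - T) 0 := by
    funext y
    rcases le_total (g p y) T with h | h
    · rw [min_eq_left h, max_eq_right (by linarith)]; ring
    · rw [min_eq_right h, max_eq_left (by linarith)]; ring
  rw [e, form_sub_right, hg.form_eq hF hf hp, form_eq_zero_of_const, sub_zero]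
  intro y z hyz hy
  refine h y z hyz (by_contra fun hn => hy (max_eq_right ?_))
  linarith

/-- Truncation is a contraction, so its energy is at most its pairing with the full Green function,
which reads off its value at the pole. -/
lemma IsGreen.form_truncate_le {D : Set V} {g : V → V → ℝ} (hg : Γ.IsGreen D g) {F : Finset V}
    (hF : Γ.closure D ⊆ F) {p : V} (hp : p ∈ D) {T : ℝ} (hT : 0 ≤ T) :
    Γ.form F (fun y => min (g p y) T) (fun y => min (g p y) T) ≤ 2 * T := by
  calc _ ≤ Γ.form F (fun y => min (g p y) T) (g p) := by
        refine form_le_form fun x y => ?_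
        rcases le_total (g p x) T with h1 | h1 <;> rcases le_total (g p y) T with h2 | h2 <;>
          simp only [min_eq_left, min_eq_right, h1, h2] <;> nlinarith
    _ = 2 * min (g p p) T := hg.form_eq hF (fun x hx => by rw [hg.zero p x hx, min_eq_left hT]) hp
    _ ≤ 2 * T := by linarith [min_le_right (g p p) T]

/-- An upper bound for the resistance by a truncated Green function. -/
lemma IsGreen.one_le_mul_form {D : Set V} {g : V → V → ℝ} (hg : Γ.IsGreen D g) {F : Finset V}
    (hF : Γ.closure D ⊆ F) {f : V → ℝ} (hf : ∀ x ∉ D, f x = 0) {p : V} (hp : p ∈ D)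
    (hfp : f p = 1) {T : ℝ} (hT : 0 ≤ T)
    (h : ∀ y z, Γ.graph.Adj y z → T < g p y → f y = f z) :
    2 ≤ T * Γ.form F f f := by
  have h1 := hg.form_truncate_right hF hf hp h
  have h2 := hg.form_truncate_le hF hp hT
  have h3 := form_cauchy_schwarz (Γ := Γ) F f (fun y => min (g p y) T)
  rw [h1, hfp] at h3
  have h4 := mul_le_mul_of_nonneg_left h2 (form_self_nonneg (Γ := Γ) F f)
  nlinarith

/-- An upper bound for the resistance between two sets by truncated Green functions. -/
lemma IsGreen.one_le_mul_form_pair {D : Set V} {g : V → V → ℝ} (hg : Γ.IsGreen D g) {F : Finset V}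
    (hF : Γ.closure D ⊆ F) {f : V → ℝ} (hf : ∀ x ∉ D, f x = 0) {p q : V} (hp : p ∈ D) (hq : q ∈ D)
    (hfp : f p = 1) (hfq : f q = 0) {T T' : ℝ} (hT : 0 ≤ T) (hT' : 0 ≤ T')
    (h : ∀ y z, Γ.graph.Adj y z → T < g p y → f y = f z)
    (h' : ∀ y z, Γ.graph.Adj y z → T' < g q y → f y = f z)
    (hpq : g p q ≤ T)
    (hT'p : ∀ y z, Γ.graph.Adj y z → T' < g q y → g p y ≤ T ∧ g p z ≤ T) (hqp : g q p ≤ T') :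
    2 ≤ (T + T' - 2 * g p q) * Γ.form F f f := by
  set t := fun y => min (g p y) T with ht
  set t' := fun y => min (g q y) T' with ht'
  have ht0 : ∀ x ∉ D, t x = 0 := fun x hx => by simp only [ht, hg.zero p x hx, min_eq_left hT]
  have hcross : Γ.form F t t' = 2 * g p q := by
    have e : t' = fun y => g q y - max (g q y - T') 0 := by
      funext y
      simp only [ht']
      rcases le_total (g q y) T' with h | h
      · rw [min_eq_left h, max_eq_right (by linarith)]; ring
      · rw [min_eq_right h, max_eq_left (by linarith)]; ring
    have e' : t = fun y => g p y - max (g p y - T) 0 := by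
      funext y
      simp only [ht]
      rcases le_total (g p y) T with h | h
      · rw [min_eq_left h, max_eq_right (by linarith)]; ring
      · rw [min_eq_right h, max_eq_left (by linarith)]; ring
    have z1 : Γ.form F t (fun y => max (g q y - T') 0) = 0 := by
      rw [form_comm, e', form_sub_right, hg.form_eq hF (fun x hx => by
          rw [hg.zero q x hx]; exact max_eq_right (by linarith)) hp,
        max_eq_right (by linarith), form_comm, form_eq_zero_of_const]
      · ring
      · intro y z hyz hy
        have hlt : T' < g q y := by
          by_contra hn
          exact hy (max_eq_right (by linarith))
        obtain ⟨a, b⟩ := hT'p y z hyz hlt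
        rw [max_eq_right (by linarith), max_eq_right (by linarith)]
    rw [e, form_sub_right, z1, sub_zero, hg.form_eq hF ht0 hq]
    simp only [ht]
    rw [min_eq_left hpq]
  have h1 := hg.form_truncate_right hF hf hp h
  have h1' := hg.form_truncate_right hF hf hq h'
  have h2 := hg.form_truncate_le hF hp hT
  have h2' := hg.form_truncate_le hF hq hT'
  -- The test function is the dipole t - t'. Its mutual-energy term removes whatever large constant
  -- T and T' have in common with g p q.
  have hpsi : Γ.form F (fun y => t y - t' y) (fun y => t y - t' y) ≤
      2 * (T + T' - 2 * g p q) := by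
    rw [form_sub_right, form_comm F (fun y => t y - t' y) t, form_sub_right,
      form_comm F (fun y => t y - t' y) t', form_sub_right, form_comm F t' t, hcross]
    linarith
  have h3 := form_cauchy_schwarz (Γ := Γ) F f (fun y => t y - t' y)
  rw [form_sub_right, h1, h1', hfp, hfq] at h3
  have h4 := mul_le_mul_of_nonneg_left hpsi (form_self_nonneg (Γ := Γ) F f)
  nlinarith

/-! ### Harnack chains -/

variable (Γ)

/-- The elliptic Harnack inequality with constant `H`. -/
def HarnackWith (H : ℝ) : Prop :=
  ∀ (x : V) (R : ℝ), 0 < R → ∀ u : V → ℝ,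
    (∀ y, Γ.d x y < 2 * R + 1 → 0 ≤ u y) → (∀ y, Γ.d x y < 2 * R → Γ.lap u y = 0) →
      ∀ y z, Γ.d x y < R → Γ.d x z < R → u y ≤ H * u z

variable {Γ}

lemma Harnack.exists_harnackWith [Infinite V] (hΓ : Γ.LocFin) (hH : Γ.Harnack) :
    ∃ H : ℝ, 1 < H ∧ Γ.HarnackWith H := by
  obtain ⟨H, h1, h⟩ := hH
  exact ⟨H, h1, fun x R hR u hu0 hu y z hy hz =>
    h x R hR u (fun y hy => hu0 y (Γ.d_of_mem_closure_ball hy))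
      (fun y hy => (markov_eq_iff hΓ u y).2 (hu y hy)) y hy z hz⟩

/-- Harnack chains along all geodesics between two points. -/
lemma HarnackWith.pow {H : ℝ} (hH : Γ.HarnackWith H) (h1 : 1 ≤ H) {u : V → ℝ} {t : ℝ} {k : ℕ}
    (hk : (k : ℝ) < t) (n : ℕ) : ∀ p q : V, Γ.d p q ≤ n * k →
    (∀ z, Γ.d p z + Γ.d z q = Γ.d p q → (∀ y, Γ.d z y < 2 * t + 1 → 0 ≤ u y) ∧
      ∀ y, Γ.d z y < 2 * t → Γ.lap u y = 0) → u p ≤ H ^ n * u q := by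
  have ht : 0 < t := lt_of_le_of_lt (Nat.cast_nonneg k) hk
  induction n with
  | zero =>
    intro p q hpq _
    have : p = q := Γ.eq_of_d_eq_zero (le_antisymm (by simpa using hpq) (Γ.d_nonneg _ _))
    rw [this]; simp
  | succ n ih =>
    intro p q hpq hz
    have hp := hz p (by rw [d_self]; ring)
    have hq := (hz q (by rw [d_self]; ring)).1 q (by rw [d_self]; linarith)
    have hpow : (1 : ℝ) ≤ H ^ n := one_le_pow₀ h1
    by_cases hle : Γ.d p q ≤ k
    · have := hH p t ht u hp.1 hp.2 p q (by rwa [d_self]) (by linarith)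
      calc u p ≤ H * u q := this
        _ ≤ H ^ n * (H * u q) := le_mul_of_one_le_left (mul_nonneg (by linarith) hq) hpow
        _ = H ^ (n + 1) * u q := by ring
    · push Not at hle
      obtain ⟨z, hpz, hzq⟩ := Γ.exists_d_eq p q hle.le
      have h2 := hH p t ht u hp.1 hp.2 p z (by rwa [d_self]) (by linarith)
      have h3 := ih z q (by push_cast at hpq; linarith) (fun y hy => hz y (by
        have := Γ.d_triangle p z y
        have := Γ.d_triangle p y q
        linarith))
      calc u p ≤ H * u z := h2
        _ ≤ H * (H ^ n * u q) := mul_le_mul_of_nonneg_left h3 (by linarith)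
        _ = H ^ (n + 1) * u q := by ring

/-- Distances are integers, so the step is ⌈t⌉ - 1 < t; for t ≥ 2 it is at least t/2, hence 2N steps
cover a length N t. -/
lemma HarnackWith.chain {H : ℝ} (hH : Γ.HarnackWith H) (h1 : 1 ≤ H) {u : V → ℝ} {t : ℝ}
    (ht : 2 ≤ t) {N : ℕ} {p q : V} (hpq : Γ.d p q ≤ N * t)
    (hz : ∀ z, Γ.d p z + Γ.d z q = Γ.d p q → (∀ y, Γ.d z y < 2 * t + 1 → 0 ≤ u y) ∧
      ∀ y, Γ.d z y < 2 * t → Γ.lap u y = 0) : u p ≤ H ^ (2 * N) * u q := by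
  have hc1 := Nat.le_ceil t
  have hc2 := Nat.ceil_lt_add_one (by linarith : 0 ≤ t)
  have hc3 : 2 ≤ ⌈t⌉₊ := by exact_mod_cast ht.trans hc1
  have hcast : ((⌈t⌉₊ - 1 : ℕ) : ℝ) = ⌈t⌉₊ - 1 := by
    rw [Nat.cast_sub (by omega)]; simp
  refine hH.pow h1 (t := t) (k := ⌈t⌉₊ - 1) (by rw [hcast]; linarith) (2 * N) p q ?_ hz
  rw [hcast]
  push_cast
  have hN : (0 : ℝ) ≤ N := Nat.cast_nonneg N
  nlinarith

/-- A symmetric kernel, non-negative on a ball and harmonic off the diagonal there, has comparable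
values at well separated pairs of points. -/
lemma HarnackWith.three_point {H : ℝ} (hH : Γ.HarnackWith H) (h1 : 1 ≤ H) {k : V → V → ℝ}
    {x₀ : V} {L t : ℝ} (ht : 2 ≤ t) {N : ℕ} (hN : L ≤ N * t) (hsymm : ∀ p q, k p q = k q p)
    (h0 : ∀ p q, Γ.d x₀ p < L → Γ.d x₀ q < L + 1 → 0 ≤ k p q)
    (hk : ∀ p q, Γ.d x₀ p < L → Γ.d x₀ q < L → q ≠ p → Γ.lap (k p) q = 0) {a b c : V}
    (hab : Γ.d x₀ a + Γ.d x₀ b + 2 * t ≤ L) (hac : Γ.d x₀ a + Γ.d x₀ c + 2 * t ≤ L)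
    (hbc : Γ.d x₀ b + Γ.d x₀ c + 2 * t ≤ L) (dab : 8 * t ≤ Γ.d a b) (dac : 8 * t ≤ Γ.d a c) :
    k a b ≤ H ^ (4 * N) * k a c := by
  have da := Γ.d_nonneg x₀ a
  have db := Γ.d_nonneg x₀ b
  have dc := Γ.d_nonneg x₀ c
  have hH1 : (1 : ℝ) ≤ H ^ (2 * N) := one_le_pow₀ h1
  have hpow : H ^ (4 * N) = H ^ (2 * N) * H ^ (2 * N) := by rw [← pow_add]; congr 1; ring
  -- Direct case: keep the pole a and move b to c along geodesics staying at distance 2t from a.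
  have go : ∀ a b c, Γ.d x₀ a < L → Γ.d x₀ b + Γ.d x₀ c + 2 * t ≤ L →
      (∀ z, Γ.d b z + Γ.d z c = Γ.d b c → 2 * t ≤ Γ.d a z) → k a b ≤ H ^ (2 * N) * k a c := by
    intro a b c ha hbc hz
    refine hH.chain h1 ht ?_ fun z hbz => ?_
    · have := Γ.d_triangle b x₀ c
      rw [Γ.d_comm b x₀] at this
      linarith
    · have hzx : Γ.d x₀ z + 2 * t ≤ L := by
        have e1 := Γ.d_triangle x₀ b z
        have e2 := Γ.d_triangle x₀ c z
        have e3 := Γ.d_triangle b x₀ c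
        rw [Γ.d_comm b x₀] at e3
        rw [Γ.d_comm c z] at e2
        linarith
      refine ⟨fun y hy => h0 a y ha ?_, fun y hy => hk a y ha ?_ ?_⟩
      · have := Γ.d_triangle x₀ z y; linarith
      · have := Γ.d_triangle x₀ z y; linarith
      · rintro rfl
        have := hz z hbz
        rw [Γ.d_comm] at this
        linarith
  by_cases hav : ∀ z, Γ.d b z + Γ.d z c = Γ.d b c → 2 * t ≤ Γ.d a z
  · have h2 := go a b c (by linarith) hbc hav
    have h3 : 0 ≤ k a c := h0 a c (by linarith) (by linarith)
    calc k a b ≤ H ^ (2 * N) * k a c := h2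
      _ ≤ H ^ (2 * N) * (H ^ (2 * N) * k a c) :=
        le_mul_of_one_le_left (mul_nonneg (by linarith) h3) hH1
      _ = _ := by rw [hpow]; ring
  -- Some geodesic from b to c passes near a. Then geodesics from a to c avoid b and those from b to
  -- a avoid c, so go from k a b to k b c with pole b, then to k c a with pole c.
  · push Not at hav
    obtain ⟨z, hz, haz⟩ := hav
    have t1 := Γ.d_triangle a z b
    have t2 := Γ.d_triangle a z c
    rw [Γ.d_comm z b] at t1
    have h2 : k b a ≤ H ^ (2 * N) * k b c := go b a c (by linarith) hac fun y hy => by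
      by_contra! hlt
      have := Γ.d_triangle b y c
      have := Γ.d_nonneg a y
      have := Γ.d_triangle a y b
      rw [Γ.d_comm y b] at this
      linarith
    have h3 : k c b ≤ H ^ (2 * N) * k c a := go c b a (by linarith) (by linarith) fun y hy => by
      by_contra! hlt
      have := Γ.d_triangle b y c
      have := Γ.d_triangle a y c
      rw [Γ.d_comm y c] at *
      rw [Γ.d_comm y a, Γ.d_comm b a] at hy
      linarith
    rw [hsymm a b, hsymm a c, hpow, mul_assoc]
    refine h2.trans (mul_le_mul_of_nonneg_left ?_ (by linarith))
    rw [hsymm b c]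
    exact h3

/-! ### Extremum principles on spheres; the inner radius -/

lemma d_eq_nat {x y : V} {n : ℕ} (h1 : (n : ℝ) - 1 < Γ.d x y) (h2 : Γ.d x y ≤ n) :
    Γ.d x y = n := by
  unfold d at *
  have h2' : Γ.graph.dist x y ≤ n := by exact_mod_cast h2
  have h1' : n < Γ.graph.dist x y + 1 := by
    have : (n : ℝ) < Γ.graph.dist x y + 1 := by linarith
    exact_mod_cast this
  have : Γ.graph.dist x y = n := by omega
  rw [this]

/-- Outside the sphere there is no pole, and the function vanishes off D: the maximum principle
applies. -/
lemma IsGreen.le_of_sphere [Infinite V] (hΓ : Γ.LocFin) {D : Set V} (hD : D.Finite)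
    {g : V → V → ℝ} (hg : Γ.IsGreen D g) {p : V} {n : ℕ} {T : ℝ} (hT : 0 ≤ T)
    (h : ∀ z, Γ.d p z = n → g p z ≤ T) {z : V} (hz : (n : ℝ) ≤ Γ.d p z) : g p z ≤ T := by
  rcases hz.eq_or_lt with heq | hlt
  · exact h z heq.symm
  · by_cases hzD : z ∈ D
    · have := nonneg_of_superharmonic hΓ (W := D ∩ {y | (n : ℝ) < Γ.d p y})
        (hD.subset Set.inter_subset_left) (u := fun y => T - g p y)
        (fun y hy => by
          rw [lap_const_sub hΓ, hg.lap_ne p y hy.1, neg_zero]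
          rintro rfl
          have h2 : (n : ℝ) < Γ.d y y := hy.2
          rw [d_self] at h2
          exact absurd h2 (not_lt.2 (Nat.cast_nonneg n)))
        (fun y hy w hyw hw => by
          have h2 : (n : ℝ) < Γ.d p y := hy.2
          by_cases hwD : w ∈ D
          · have h3 : Γ.d p w ≤ n := not_lt.1 fun h => hw ⟨hwD, h⟩
            have h4 := Γ.d_le_of_adj p hyw.symm
            linarith [h w (d_eq_nat (by linarith) h3)]
          · rw [hg.zero p w hwD]; linarith) z ⟨hzD, hlt⟩
      linarith
    · rw [hg.zero p z hzD]; exact hT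

lemma le_of_superharmonic [Infinite V] (hΓ : Γ.LocFin) {v : V → ℝ} {x : V} {n : ℕ}
    (hv : ∀ z, Γ.d x z < n → 0 ≤ Γ.lap v z) {c : ℝ} (h : ∀ z, Γ.d x z = n → c ≤ v z) {z : V}
    (hz : Γ.d x z ≤ n) : c ≤ v z := by
  rcases hz.eq_or_lt with heq | hlt
  · exact h z heq
  · have := nonneg_of_superharmonic hΓ (W := {y | Γ.d x y < n}) (finite_ball hΓ x n)
      (u := fun y => v y - c) (fun y hy => by rw [lap_sub_const]; exact hv y hy)
      (fun y hy w hyw hw => by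
        have h2 : Γ.d x y < n := hy
        have h3 : (n : ℝ) ≤ Γ.d x w := not_lt.1 hw
        have h4 := Γ.d_le_of_adj x hyw
        linarith [h w (d_eq_nat (by linarith) (by
          unfold d at *
          have h2' : Γ.graph.dist x y + 1 ≤ n := by exact_mod_cast h2
          have : (Γ.graph.dist x y : ℝ) + 1 ≤ n := by exact_mod_cast h2'
          linarith))]) z hlt
    linarith

/-- Decreasing the inner radius of an annulus, at large scales. -/
lemma HarnackWith.rho_le_mul_rho_two_mul [Infinite V] (hΓ : Γ.LocFin) {H : ℝ} (h1 : 1 ≤ H)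
    (hH : Γ.HarnackWith H) {C : ℝ≥0} (hC : (C : ℝ) = H ^ 1024) {x : V} {R : ℝ} (hR : 256 ≤ R) :
    Γ.rho x R (4 * R) ≤ C * Γ.rho x (2 * R) (4 * R) := by
  have hCpos : (0 : ℝ) < C := by rw [hC]; positivity
  have hD := finite_ball hΓ x (4 * R)
  have hcl := hΓ.finite_closure hD
  have hF : Γ.closure (Γ.ball x (4 * R)) ⊆ hcl.toFinset := by simp
  refine rho_le_mul hΓ hF hF (by exact_mod_cast hCpos) fun f hf1 hf0 => ?_
  have hfD : ∀ y ∉ Γ.ball x (4 * R), f y = 0 := fun y hy => hf0 y (not_lt.1 fun h => hy h)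
  have hxD : x ∈ Γ.ball x (4 * R) := by rw [mem_ball, d_self]; linarith
  obtain ⟨g, hg⟩ := exists_isGreen hΓ hD
  have b1 := Nat.le_ceil (R / 2)
  have b2 := Nat.ceil_lt_add_one (by linarith : 0 ≤ R / 2)
  have b3 := Nat.le_ceil (2 * R)
  have b4 := Nat.ceil_lt_add_one (by linarith : 0 ≤ 2 * R)
  -- Spheres need integer radii. Rounding leaves n₁ + 1 below R, where f = 1, and n₂ at least 2R, so
  -- that the truncation at m is constant on B(x,2R).
  set n₁ := ⌈R / 2⌉₊
  set n₂ := ⌈2 * R⌉₊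
  obtain ⟨c, hc, hmin⟩ := Set.exists_min_image {z | Γ.d x z = n₂} (g x)
    ((finite_le hΓ x n₂).subset fun z hz => le_of_eq hz) (exists_sphere hΓ x n₂)
  have hc : Γ.d x c = n₂ := hc
  set m := g x c
  have hm0 : 0 ≤ m := hg.nonneg x c
  have hsph : ∀ z, Γ.d x z = n₁ → g x z ≤ C * m := by
    intro z hz
    rw [hC]
    -- L = 4R is 256 steps of R/64, whence the exponent 4 * 256 = 1024; R ≥ 256 ensures t ≥ 2.
    refine hH.three_point h1 (x₀ := x) (L := 4 * R) (t := R / 64) (N := 256) (by linarith)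
      (by push_cast; linarith) hg.symm (fun p q _ _ => hg.nonneg p q)
      (fun p q _ hq => hg.lap_ne p q hq) ?_ ?_ ?_ ?_ ?_
    · rw [d_self, hz]; linarith
    · rw [d_self, hc]; linarith
    · rw [hz, hc]; linarith
    · rw [hz]; linarith
    · rw [hc]; linarith
  have hout : ∀ z, (n₁ : ℝ) ≤ Γ.d x z → g x z ≤ C * m := fun z hz =>
    hg.le_of_sphere hΓ hD (mul_nonneg hCpos.le hm0) hsph hz
  have hin : ∀ z, Γ.d x z ≤ n₂ → m ≤ g x z := fun z hz =>
    le_of_superharmonic hΓ (fun y hy => hg.lap_nonneg x (Γ.mem_ball.2 (by linarith))) hmin hz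
  have hlow := hg.one_le_mul_form hF hfD hxD (hf1 x (by rw [d_self]; linarith))
    (T := C * m) (mul_nonneg hCpos.le hm0) fun y z hyz hT => by
      have hy : Γ.d x y < n₁ := by
        by_contra! h
        exact not_lt.2 (hout y h) hT
      have := Γ.d_le_of_adj x hyz
      rw [hf1 y (by linarith), hf1 z (by linarith)]
  have hm : 0 < m := by
    refine lt_of_le_of_ne hm0 fun h => ?_
    rw [← h] at hlow
    norm_num at hlow
  refine ⟨fun y => m⁻¹ * min (g x y) m, fun y hy => ?_, fun y hy => ?_, ?_⟩
  · beta_reduce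
    rw [min_eq_right (hin y (by linarith)), inv_mul_cancel₀ hm.ne']
  · beta_reduce
    rw [hg.zero x y fun h => not_lt.2 hy (Γ.mem_ball.1 h), min_eq_left hm0, mul_zero]
  · rw [form_const_mul_self]
    have h2 := hg.form_truncate_le hF hxD hm0
    have h3 := mul_le_mul_of_nonneg_left h2 (by positivity : 0 ≤ (m⁻¹) ^ 2)
    refine h3.trans ?_
    rw [show m⁻¹ ^ 2 * (2 * m) = m⁻¹ * 2 by field_simp]
    rw [inv_mul_le_iff₀ hm]
    linarith

/-! ### Bounded scales under (p₀) -/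

section Small

variable {p₀ : ℝ}

lemma mul_mu_le (hp : ∀ x y, Γ.graph.Adj x y → p₀ ≤ Γ.w x y / Γ.mu x) [Infinite V] {y z : V}
    (h : Γ.graph.Adj y z) : p₀ * Γ.mu y ≤ Γ.w y z :=
  (le_div_iff₀ (mu_pos y)).1 (hp y z h)

lemma exists_adj_of_lt {x y : V} {n : ℕ} (h : (n : ℝ) < Γ.d x y)
    (h' : Γ.d x y ≤ ((n + 1 : ℕ) : ℝ)) : ∃ z, Γ.d x z = n ∧ Γ.graph.Adj z y := by
  obtain ⟨z, hxz, hzy⟩ := Γ.exists_d_eq x y h.le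
  push_cast at h'
  have h1 : Γ.d z y = (1 : ℕ) := d_eq_nat (by push_cast; linarith) (by push_cast; linarith)
  unfold d at h1
  exact ⟨z, hxz, SimpleGraph.dist_eq_one_iff_adj.1 (by exact_mod_cast h1)⟩

lemma pow_mul_mu_le [Infinite V] (h0 : 0 < p₀)
    (hp : ∀ x y, Γ.graph.Adj x y → p₀ ≤ Γ.w x y / Γ.mu x) (n : ℕ) (x y : V)
    (hxy : Γ.d x y ≤ n) : p₀ ^ n * Γ.mu x ≤ Γ.mu y := by
  have hp1 : p₀ ≤ 1 := by
    obtain ⟨z, hz⟩ := exists_adj (Γ := Γ) x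
    exact (hp x z hz).trans ((div_le_one (mu_pos x)).2 (w_le_mu x z))
  induction n generalizing y with
  | zero =>
    rw [Γ.eq_of_d_eq_zero (le_antisymm (by simpa using hxy) (Γ.d_nonneg x y))]
    simp
  | succ n ih =>
    by_cases h : Γ.d x y ≤ n
    · refine le_trans (mul_le_mul_of_nonneg_right ?_ (mu_pos x).le) (ih y h)
      rw [pow_succ]
      exact mul_le_of_le_one_right (pow_pos h0 n).le hp1
    · push Not at h
      obtain ⟨z, hxz, hzy⟩ := exists_adj_of_lt h hxy
      calc p₀ ^ (n + 1) * Γ.mu x = p₀ * (p₀ ^ n * Γ.mu x) := by ring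
        _ ≤ p₀ * Γ.mu z := mul_le_mul_of_nonneg_left (ih z hxz.le) h0.le
        _ ≤ Γ.w z y := mul_mu_le hp hzy
        _ ≤ Γ.mu y := by rw [Γ.w_symm]; exact w_le_mu y z

lemma w_mul_sq_le_form {F : Finset V} {y z : V} (hy : y ∈ F) (hz : z ∈ F) (f : V → ℝ) :
    Γ.w y z * (f y - f z) ^ 2 ≤ Γ.form F f f := by
  have h1 : ∀ x ∈ F, 0 ≤ ∑ y ∈ F, Γ.w x y * ((f x - f y) * (f x - f y)) := fun x _ =>
    Finset.sum_nonneg fun y _ => mul_nonneg (w_nonneg _ _) (mul_self_nonneg _)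
  have h2 := Finset.single_le_sum h1 hy
  have h3 := Finset.single_le_sum (f := fun z => Γ.w y z * ((f y - f z) * (f y - f z)))
    (fun z _ => mul_nonneg (w_nonneg y z) (mul_self_nonneg _)) hz
  rw [pow_two]
  exact h3.trans h2

/-- Along a geodesic from x of length at most n, edge weights are at least a fixed multiple of μ(x),
so f x - f y telescopes at bounded cost. -/
lemma exists_mul_sq_le_form [Infinite V] (h0 : 0 < p₀)
    (hp : ∀ x y, Γ.graph.Adj x y → p₀ ≤ Γ.w x y / Γ.mu x) (n : ℕ) :
    ∃ C : ℝ, 0 ≤ C ∧ ∀ (x y : V) (F : Finset V) (f : V → ℝ), (∀ z, Γ.d x z ≤ n → z ∈ F) →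
      Γ.d x y ≤ n → Γ.mu x * (f x - f y) ^ 2 ≤ C * Γ.form F f f := by
  induction n with
  | zero =>
    refine ⟨0, le_rfl, fun x y F f _ hxy => ?_⟩
    rw [Γ.eq_of_d_eq_zero (le_antisymm (by simpa using hxy) (Γ.d_nonneg x y))]
    simp
  | succ n ih =>
    obtain ⟨C, hC, h⟩ := ih
    have hq : 0 < p₀ ^ (n + 1) := pow_pos h0 _
    refine ⟨2 * C + 2 * (p₀ ^ (n + 1))⁻¹, by positivity, fun x y F f hF hxy => ?_⟩
    have hF' : ∀ z, Γ.d x z ≤ n → z ∈ F := fun z hz => hF z (by push_cast; linarith)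
    have hE := form_self_nonneg (Γ := Γ) F f
    have hi : 0 ≤ (p₀ ^ (n + 1))⁻¹ * Γ.form F f f := mul_nonneg (inv_pos.2 hq).le hE
    by_cases hd : Γ.d x y ≤ n
    · have := h x y F f hF' hd
      have := mul_nonneg hC hE
      nlinarith
    · push Not at hd
      obtain ⟨z, hxz, hzy⟩ := exists_adj_of_lt hd hxy
      have h1 := h x z F f hF' hxz.le
      have h2 := w_mul_sq_le_form (Γ := Γ) (hF' z hxz.le) (hF y hxy) f
      have h3 : p₀ ^ (n + 1) * Γ.mu x ≤ Γ.w z y := by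
        refine le_trans ?_ (mul_mu_le hp hzy)
        rw [pow_succ, mul_comm _ p₀, mul_assoc]
        exact mul_le_mul_of_nonneg_left (pow_mul_mu_le h0 hp n x z hxz.le) h0.le
      have h4 : p₀ ^ (n + 1) * Γ.mu x * (f z - f y) ^ 2 ≤ Γ.form F f f :=
        (mul_le_mul_of_nonneg_right h3 (sq_nonneg _)).trans h2
      have h5 : Γ.mu x * (f z - f y) ^ 2 ≤ (p₀ ^ (n + 1))⁻¹ * Γ.form F f f := by
        rw [inv_mul_eq_div, le_div_iff₀ hq]; linarith
      have h6 : (f x - f y) ^ 2 ≤ 2 * (f x - f z) ^ 2 + 2 * (f z - f y) ^ 2 := by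
        nlinarith [sq_nonneg ((f x - f z) - (f z - f y))]
      have h7 := mul_le_mul_of_nonneg_left h6 (mu_pos (Γ := Γ) x).le
      linarith

/-- A vertex z of the next sphere has a neighbour y in the ball with μ(z) ≤ p₀⁻¹ w(y,z), and these
weights sum to at most μ(y) over z. -/
lemma exists_sum_mu_le [Infinite V] (hΓ : Γ.LocFin) (h0 : 0 < p₀)
    (hp : ∀ x y, Γ.graph.Adj x y → p₀ ≤ Γ.w x y / Γ.mu x) (n : ℕ) :
    ∃ C : ℝ, 0 ≤ C ∧ ∀ x : V, ∑ y ∈ (finite_le hΓ x n).toFinset, Γ.mu y ≤ C * Γ.mu x := by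
  classical
  induction n with
  | zero =>
    refine ⟨1, zero_le_one, fun x => ?_⟩
    rw [Finset.sum_eq_single x]
    · linarith
    · intro y hy hyx
      have h : Γ.d x y ≤ (0 : ℕ) := by simpa using hy
      exact absurd (Γ.eq_of_d_eq_zero (le_antisymm (by simpa using h) (Γ.d_nonneg x y))).symm hyx
    · intro h
      exact absurd (by simp [d_self]) h
  | succ n ih =>
    obtain ⟨C, hC, h⟩ := ih
    refine ⟨(1 + p₀⁻¹) * C, by positivity, fun x => ?_⟩
    set B := (finite_le hΓ x n).toFinset with hB
    set B' := (finite_le hΓ x (n + 1)).toFinset with hB'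
    have hsub : B ⊆ B' := by
      intro y hy
      have : Γ.d x y ≤ n := by simpa [hB] using hy
      simp only [hB', Set.Finite.mem_toFinset, Set.mem_ofPred_eq]
      push_cast; linarith
    have hterm : ∀ z ∈ B', Γ.mu z ≤ (if z ∈ B then Γ.mu z else 0) + ∑ y ∈ B, p₀⁻¹ * Γ.w y z := by
      intro z hz
      have hz' : Γ.d x z ≤ ((n + 1 : ℕ) : ℝ) := by simpa [hB'] using hz
      have hnn : ∀ y ∈ B, 0 ≤ p₀⁻¹ * Γ.w y z := fun y _ =>
        mul_nonneg (inv_pos.2 h0).le (w_nonneg _ _)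
      split_ifs with hzB
      · linarith [Finset.sum_nonneg hnn]
      · have hlt : (n : ℝ) < Γ.d x z := by simpa [hB] using hzB
        obtain ⟨y, hxy, hadj⟩ := exists_adj_of_lt hlt hz'
        have h2 := mul_mu_le hp hadj.symm
        rw [Γ.w_symm] at h2
        have h3 := Finset.single_le_sum hnn (a := y) (by simp [hB, hxy])
        have h4 : Γ.mu z ≤ p₀⁻¹ * Γ.w y z := by
          rw [inv_mul_eq_div, le_div_iff₀ h0]; linarith
        linarith
    have hB2 : ∑ z ∈ B', (if z ∈ B then Γ.mu z else 0) = ∑ z ∈ B, Γ.mu z := by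
      rw [Finset.sum_ite_mem, Finset.inter_eq_right.2 hsub]
    have hB3 : ∑ z ∈ B', ∑ y ∈ B, p₀⁻¹ * Γ.w y z ≤ p₀⁻¹ * ∑ y ∈ B, Γ.mu y := by
      rw [Finset.sum_comm, Finset.mul_sum]
      refine Finset.sum_le_sum fun y _ => ?_
      rw [← Finset.mul_sum]
      exact mul_le_mul_of_nonneg_left
        ((Γ.w_summable y).sum_le_tsum _ fun z _ => w_nonneg y z) (inv_pos.2 h0).le
    calc _ ≤ ∑ z ∈ B', ((if z ∈ B then Γ.mu z else 0) + ∑ y ∈ B, p₀⁻¹ * Γ.w y z) :=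
          Finset.sum_le_sum hterm
      _ ≤ ∑ y ∈ B, Γ.mu y + p₀⁻¹ * ∑ y ∈ B, Γ.mu y := by
          rw [Finset.sum_add_distrib, hB2]; linarith
      _ = (1 + p₀⁻¹) * ∑ y ∈ B, Γ.mu y := by ring
      _ ≤ (1 + p₀⁻¹) * (C * Γ.mu x) :=
          mul_le_mul_of_nonneg_left (h x) (by positivity)
      _ = _ := by ring

lemma form_indicator_le (F S : Finset V) (hS : S ⊆ F) [DecidableEq V] :
    Γ.form F (fun y => if y ∈ S then 1 else 0) (fun y => if y ∈ S then 1 else 0) ≤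
      2 * ∑ y ∈ S, Γ.mu y := by
  rw [form_eq_sum]
  simp only [ite_mul, one_mul, zero_mul]
  rw [Finset.sum_ite_mem, Finset.inter_eq_right.2 hS]
  refine mul_le_mul_of_nonneg_left (Finset.sum_le_sum fun x hx => ?_) zero_le_two
  refine le_trans (Finset.sum_le_sum (g := fun y => Γ.w x y) fun y _ => ?_)
    ((Γ.w_summable x).sum_le_tsum _ fun z _ => w_nonneg x z)
  refine mul_le_of_le_one_right (w_nonneg _ _) ?_
  rw [if_pos hx]; split_ifs <;> norm_num

/-- Resistances of annuli of bounded radius are comparable. -/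
lemma exists_rho_le_mul_of_le [Infinite V] (h0 : 0 < p₀)
    (hp : ∀ x y, Γ.graph.Adj x y → p₀ ≤ Γ.w x y / Γ.mu x) (N : ℕ) :
    ∃ C : ℝ≥0, ∀ (x : V) (r R r' R' : ℝ), 0 < r → R ≤ N → r' ≤ R' → R' ≤ N →
      Γ.rho x r R ≤ C * Γ.rho x r' R' := by
  classical
  have hΓ := locFin_of_le h0 hp
  obtain ⟨C₁, hC₁, h₁⟩ := exists_mul_sq_le_form h0 hp N
  obtain ⟨C₂, hC₂, h₂⟩ := exists_sum_mu_le hΓ h0 hp N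
  obtain ⟨C, hC⟩ : ∃ C : ℝ≥0, (C : ℝ) = 2 * C₂ * C₁ + 1 :=
    ⟨_, Real.coe_toNNReal _ (by positivity)⟩
  refine ⟨C, fun x r R r' R' hr hR hr' hR' => ?_⟩
  set F := (finite_le hΓ x (N + 1)).toFinset with hFdef
  have hF : ∀ R : ℝ, R ≤ N → Γ.closure (Γ.ball x R) ⊆ F := by
    intro R hR y hy
    have := Γ.d_of_mem_closure_ball hy
    simp only [hFdef, Set.Finite.coe_toFinset, Set.mem_ofPred_eq]
    push_cast; linarith
  refine rho_le_mul hΓ (hF R hR) (hF R' hR') (by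
    rw [← NNReal.coe_pos, hC]; positivity) fun f hf1 hf0 => ?_
  -- A path from x, where f = 1, to distance N, where f = 0, bounds the energy of f below by a
  -- multiple of μ(x); the indicator of B(x,r') has energy at most a multiple of μ(x).
  obtain ⟨y, hy⟩ := exists_sphere hΓ x N
  have hlow := h₁ x y F f (fun z hz => by
    simp only [hFdef, Set.Finite.mem_toFinset, Set.mem_ofPred_eq]
    push_cast; linarith) hy.le
  rw [hf1 x (by rwa [d_self]), hf0 y (by linarith)] at hlow
  set S := (finite_ball hΓ x r').toFinset with hS
  set B := (finite_le hΓ x N).toFinset with hB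
  have hmem : ∀ y, y ∈ S ↔ Γ.d x y < r' := fun y => by simp [hS, mem_ball]
  have hSB : S ⊆ B := fun y hy => by
    have := (hmem y).1 hy
    simp only [hB, Set.Finite.mem_toFinset, Set.mem_ofPred_eq]
    linarith
  have hSF : S ⊆ F := fun y hy => hF R' hR' (Or.inl (Γ.mem_ball.2 (((hmem y).1 hy).trans_le hr')))
  refine ⟨fun y => if y ∈ S then 1 else 0, fun y hy => if_pos ((hmem y).2 hy),
    fun y hy => if_neg fun h => ?_, ?_⟩
  · exact absurd ((hmem y).1 h) (not_lt.2 (hr'.trans hy))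
  · have e1 := form_indicator_le (Γ := Γ) F S hSF
    have e2 : ∑ y ∈ S, Γ.mu y ≤ ∑ y ∈ B, Γ.mu y :=
      Finset.sum_le_sum_of_subset_of_nonneg hSB fun y _ _ => (mu_pos y).le
    have e3 := h₂ x
    have e4 := mul_le_mul_of_nonneg_left hlow (by positivity : 0 ≤ 2 * C₂)
    have e5 := form_self_nonneg (Γ := Γ) F f
    rw [hC]
    linarith

end Small

/-! ### Two separated balls with nearly constant potentials -/

section TwoBalls

variable {H R δ : ℝ} {x₀ a b : V} {A B : Finset V} {e e' : V → ℝ} {M M' : ℝ}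

/-- An equilibrium potential that is almost maximal near `b` is so at all points joined to `b` by
geodesics avoiding its pole `a`. -/
lemma IsEquilibrium.sub_le_of_avoid (hΓ : Γ.LocFin) (h1 : 1 ≤ H) (hH : Γ.HarnackWith H)
    (hR : 256 ≤ R) (he : Γ.IsEquilibrium (Γ.ball x₀ (20 * R)) A e M)
    (hA : ∀ y ∈ A, Γ.d a y < R / 64) (hb : Γ.d x₀ b ≤ 3 * R) (hab : R / 2 ≤ Γ.d a b)
    {b₁ : V} (hb₁ : Γ.d b b₁ < R / 64) (hδ : M - e b₁ ≤ δ) :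
    (∀ y, Γ.d b y < R / 64 → M - e y ≤ H * δ) ∧
    ∀ p, Γ.d x₀ p ≤ 14 * R → (∀ z, Γ.d p z + Γ.d z b = Γ.d p b → R / 16 ≤ Γ.d a z) →
      M - e p ≤ H ^ 2177 * δ := by
  have hharm : ∀ y, Γ.d x₀ y < 20 * R → R / 64 ≤ Γ.d a y → Γ.lap (fun y => M - e y) y = 0 := by
    intro y hy hay
    rw [lap_const_sub hΓ, he.lap_zero y hy fun h => not_lt.2 hay (hA y h), neg_zero]
  have hnn : ∀ y, 0 ≤ M - e y := fun y => sub_nonneg.2 (he.le y)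
  have hnear : ∀ y, Γ.d b y < R / 64 → M - e y ≤ H * δ := by
    intro y hy
    refine (hH b (R / 64) (by linarith) (fun y => M - e y) (fun y _ => hnn y) (fun z hz => ?_)
      y b₁ hy hb₁).trans (mul_le_mul_of_nonneg_left hδ (by linarith))
    refine hharm z ?_ ?_
    · linarith [Γ.d_triangle x₀ b z]
    · have := Γ.d_triangle a z b
      rw [Γ.d_comm z b] at this
      linarith
  refine ⟨hnear, fun p hp hz => ?_⟩
  -- d(p,b) ≤ 14R + 3R is 1088 steps of R/64. The exponent 2177 is 2 * 1088 plus one for the Harnack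
  -- step near b.
  have hc := hH.chain h1 (u := fun y => M - e y) (t := R / 64) (N := 1088) (p := p) (q := b)
    (by linarith) (by
      have := Γ.d_triangle p x₀ b
      rw [Γ.d_comm p x₀] at this
      push_cast
      linarith) fun z hpz => ⟨fun y _ => hnn y, fun y hy => hharm y ?_ ?_⟩
  · refine hc.trans ?_
    have h2 := hnear b (by rw [d_self]; linarith)
    calc H ^ (2 * 1088) * (M - e b) ≤ H ^ (2 * 1088) * (H * δ) :=
          mul_le_mul_of_nonneg_left h2 (by positivity)
      _ = H ^ 2177 * δ := by ring
  · have e1 := Γ.d_triangle x₀ p z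
    have e2 := Γ.d_triangle x₀ b z
    have e3 := Γ.d_triangle p x₀ b
    have e4 := Γ.d_triangle x₀ z y
    rw [Γ.d_comm p x₀] at e3
    rw [Γ.d_comm b z] at e2
    linarith
  · have e1 := Γ.d_triangle a y z
    rw [Γ.d_comm y z] at e1
    linarith [hz z hpz]

/-- Two separated balls at small resistance from each other: both equilibrium potentials are almost
constant. -/
lemma IsEquilibrium.sub_le_of_pair [Infinite V] (hΓ : Γ.LocFin) (h1 : 1 ≤ H)
    (hH : Γ.HarnackWith H) (hR : 256 ≤ R)
    (he : Γ.IsEquilibrium (Γ.ball x₀ (20 * R)) A e M)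
    (he' : Γ.IsEquilibrium (Γ.ball x₀ (20 * R)) B e' M')
    (hA : ∀ y ∈ A, Γ.d a y < R / 64) (hB : ∀ y ∈ B, Γ.d b y < R / 64)
    (ha : Γ.d x₀ a ≤ 3 * R) (hb : Γ.d x₀ b ≤ 3 * R) (hab : R / 2 ≤ Γ.d a b) (hδ0 : 0 ≤ δ)
    {a₁ b₁ : V} (hb₁ : Γ.d b b₁ < R / 64) (hδ : M - e b₁ ≤ δ)
    (ha₁ : Γ.d a a₁ < R / 64) (hδ' : M' - e' a₁ ≤ δ) {p : V} (hp : Γ.d x₀ p ≤ 14 * R) :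
    M - e p ≤ (H + H ^ 2177) * δ := by
  obtain ⟨hnear, hfar⟩ := he.sub_le_of_avoid hΓ h1 hH hR hA hb hab hb₁ hδ
  obtain ⟨hnear', hfar'⟩ := he'.sub_le_of_avoid hΓ h1 hH hR hB ha (by rwa [d_comm]) ha₁ hδ'
  have hHδ : 0 ≤ H * δ := by positivity
  by_cases hav : ∀ z, Γ.d p z + Γ.d z b = Γ.d p b → R / 16 ≤ Γ.d a z
  · linarith [hfar p hp hav]
  · push Not at hav
    obtain ⟨z, hz, haz⟩ := hav
    -- A geodesic from p to b passing near a forces geodesics from p to a to avoid b, so the bound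
    -- holds for e'; domination transfers it to e.
    have h2 := hfar' p hp fun y hy => by
      by_contra! hlt
      have e1 := Γ.d_triangle p z a
      have e2 := Γ.d_triangle a z b
      have e3 := Γ.d_triangle p y b
      rw [Γ.d_comm z a] at e1
      rw [Γ.d_comm y b] at e3
      have := Γ.d_nonneg y a
      linarith
    have hγ : ∀ y ∈ B, M - H * δ ≤ e y := fun y hy => by linarith [hnear y (hB y hy)]
    by_cases hneg : M - H * δ ≤ 0
    · have := he.nonneg p
      have : 0 ≤ H ^ 2177 * δ := by positivity
      linarith
    · push Not at hneg
      have hdom := he'.mul_le hΓ (finite_ball hΓ _ _) he.nonneg (fun x hx => he.superharmonic hx)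
        hγ p
      -- The average of e over the charge of e' equals that of e' over the charge of e, which is at
      -- most M'.
      have hMM : M - H * δ ≤ M' := by
        have hcl := hΓ.finite_closure (finite_ball hΓ x₀ (20 * R))
        have e1 := he'.le_sum hγ
        rw [← he.sum_comm he' (F := hcl.toFinset) (by simp)] at e1
        exact e1.trans (he.sum_le fun y _ => he'.le y)
      have hM' := he'.pos
      have hq : (M - H * δ) / M' ≤ 1 := (div_le_one hM').2 hMM
      have hq0 : 0 ≤ (M - H * δ) / M' := div_nonneg hneg.le hM'.le
      have e3 : (M - H * δ) / M' * (M' - e' p) ≤ H ^ 2177 * δ :=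
        (mul_le_of_le_one_left (sub_nonneg.2 (he'.le p)) hq).trans h2
      have e4 : (M - H * δ) / M' * M' = M - H * δ := div_mul_cancel₀ _ hM'.ne'
      nlinarith

/-- Under the same assumptions, the Green function is almost constant at separated points. -/
lemma IsGreen.sub_le_of_pair [Infinite V] (hΓ : Γ.LocFin) (h1 : 1 ≤ H)
    (hH : Γ.HarnackWith H) (hR : 256 ≤ R) {g : V → V → ℝ}
    (hg : Γ.IsGreen (Γ.ball x₀ (20 * R)) g)
    (he : Γ.IsEquilibrium (Γ.ball x₀ (20 * R)) A e M)
    (hA : ∀ y ∈ A, Γ.d a y < R / 64) (ha : Γ.d x₀ a ≤ 3 * R) {ε : ℝ} (hε : 0 ≤ ε)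
    (hfar : ∀ p, Γ.d x₀ p ≤ 14 * R → M - e p ≤ ε) :
    ∃ m, 0 ≤ m ∧ (∀ p q, Γ.d x₀ p < 13 * R + 1 → Γ.d x₀ q < 13 * R + 1 → m ≤ g p q) ∧
      ∀ z, Γ.d x₀ z < 13 * R → R / 16 ≤ Γ.d a z → g a z - m ≤ H * ((1 + H) * ε) := by
  have hD := finite_ball hΓ x₀ (20 * R)
  have hcl := hΓ.finite_closure hD
  have hF : Γ.closure (Γ.ball x₀ (20 * R)) ⊆ hcl.toFinset := by simp
  have hH0 : 0 < H := by linarith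
  have b1 := Nat.le_ceil (13 * R)
  have b2 := Nat.ceil_lt_add_one (by linarith : 0 ≤ 13 * R)
  obtain ⟨n, hn⟩ : ∃ n, n = ⌈13 * R⌉₊ + 1 := ⟨_, rfl⟩
  have hn1 : 13 * R + 1 ≤ n := by rw [hn]; push_cast; linarith
  have hn2 : (n : ℝ) < 13 * R + 2 := by rw [hn]; push_cast; linarith
  have hZ : {z | Γ.d x₀ z = n}.Finite := (finite_le hΓ x₀ n).subset fun z hz => le_of_eq hz
  obtain ⟨z₀, hz₀⟩ := exists_sphere hΓ x₀ n
  -- The constant m is the minimum of g over pairs on an outer sphere; the minimum principle in each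
  -- variable makes it a lower bound for pairs inside.
  obtain ⟨⟨p, q⟩, ⟨hp, hq⟩, hmin⟩ := Set.exists_min_image
    ({z | Γ.d x₀ z = n} ×ˢ {z | Γ.d x₀ z = n}) (fun z => g z.1 z.2) (hZ.prod hZ)
    ⟨(z₀, z₀), hz₀, hz₀⟩
  have hp : Γ.d x₀ p = n := hp
  have hq : Γ.d x₀ q = n := hq
  set m := g p q with hm
  have hlap : ∀ y z, Γ.d x₀ z < n → 0 ≤ Γ.lap (g y) z := fun y z hz =>
    hg.lap_nonneg y (Γ.mem_ball.2 (by linarith))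
  have hU1 : ∀ y z, Γ.d x₀ y = n → Γ.d x₀ z ≤ n → m ≤ g y z := fun y z hy hz =>
    le_of_superharmonic hΓ (hlap y) (fun w hw => hmin (y, w) ⟨hy, hw⟩) hz
  have hU : ∀ y z, Γ.d x₀ y ≤ n → Γ.d x₀ z ≤ n → m ≤ g y z := fun y z hy hz =>
    le_of_superharmonic hΓ (hlap y) (fun w hw => by rw [hg.symm]; exact hU1 w y hw hy) hz
  have hball : ∀ y, Γ.d a y < 2 * (R / 64) + 1 → Γ.d x₀ y ≤ 4 * R := fun y hy => by
    linarith [Γ.d_triangle x₀ a y]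
  have hharn : ∀ z, Γ.d x₀ z ≤ n → R / 16 ≤ Γ.d a z → ∀ y w, Γ.d a y < R / 64 →
      Γ.d a w < R / 64 → g z y - m ≤ H * (g z w - m) := by
    intro z hz haz y w hy hw
    refine hH a (R / 64) (by linarith) (fun y => g z y - m) (fun y hy => ?_) (fun y hy => ?_)
      y w hy hw
    · exact sub_nonneg.2 (hU z y hz (by linarith [hball y hy]))
    · rw [lap_sub_const]
      refine hg.lap_ne z y (Γ.mem_ball.2 (by linarith [hball y (by linarith)])) ?_
      rintro rfl
      linarith
  -- The average of g q over the charge of A is e q ≥ M - ε, so by Harnack g q exceeds m by at least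
  -- (M - ε - m)/H on all of A. By domination it keeps this excess at p up to ε; but g q p = m.
  have hMm : M - m ≤ (1 + H) * ε := by
    by_cases hneg : M - ε - m ≤ 0
    · have : 0 ≤ H * ε := by positivity
      linarith
    · push Not at hneg
      have hγ : ∀ z ∈ A, m + (M - ε - m) / H ≤ g q z := by
        intro z hz
        have haq : R / 16 ≤ Γ.d a q := by linarith [Γ.d_triangle x₀ a q]
        have e1 := he.sum_le (h := g q) (c := m + H * (g q z - m)) fun y hy => by
          linarith [hharn q hq.le haq y z (hA y hy) (hA z hz)]
        rw [he.sum_green hF hg (Γ.mem_ball.2 (by linarith))] at e1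
        have e2 : (M - ε - m) / H ≤ g q z - m := by
          rw [div_le_iff₀ hH0]
          linarith [hfar q (by linarith)]
        linarith
      have hdom := he.mul_le hΓ hD (hg.nonneg q) (fun x hx => hg.lap_nonneg q hx) hγ p
      rw [hg.symm q p] at hdom
      have hm0 : 0 ≤ m := hg.nonneg p q
      have hM := he.pos
      have f1 : 0 ≤ (M - ε - m) / H := div_nonneg hneg.le hH0.le
      have f2 : (M - ε - m) / H ≤ M - ε - m := div_le_self hneg.le h1
      set γ := m + (M - ε - m) / H with hγdef
      have f3 : γ / M ≤ 1 := (div_le_one hM).2 (by linarith)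
      have f4 : 0 ≤ γ / M := div_nonneg (by linarith) hM.le
      have f5 : γ / M * (M - e p) ≤ ε := (mul_le_of_le_one_left (sub_nonneg.2 (he.le p)) f3).trans
        (hfar p (by linarith))
      have f6 : γ / M * M = γ := div_mul_cancel₀ _ hM.ne'
      have f7 : (M - ε - m) / H ≤ ε := by linarith
      rw [div_le_iff₀ hH0] at f7
      linarith
  refine ⟨m, hg.nonneg p q, fun y z hy hz => hU y z (by linarith) (by linarith),
    fun z hz haz => ?_⟩
  have e1 := he.le_sum (h := g z) (c := m + (g z a - m) / H) fun y hy => by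
    have := hharn z (by linarith) haz a y (by rw [d_self]; linarith) (hA y hy)
    have : (g z a - m) / H ≤ g z y - m := by rw [div_le_iff₀ hH0]; linarith
    linarith
  rw [he.sum_green hF hg (Γ.mem_ball.2 (by linarith))] at e1
  have e2 : (g z a - m) / H ≤ (1 + H) * ε := by linarith [he.le z]
  rw [div_le_iff₀ hH0] at e2
  rw [hg.symm a z]
  linarith

/-- Two separated balls at small resistance from each other force the resistance of the annulus to
be small. -/
lemma one_le_mul_form_of_pair [Infinite V] (hΓ : Γ.LocFin) (h1 : 1 ≤ H)
    (hH : Γ.HarnackWith H) (hR : 256 ≤ R)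
    (he : Γ.IsEquilibrium (Γ.ball x₀ (20 * R)) A e M)
    (he' : Γ.IsEquilibrium (Γ.ball x₀ (20 * R)) B e' M')
    (hA : ∀ y ∈ A, Γ.d a y < R / 64) (hB : ∀ y ∈ B, Γ.d b y < R / 64)
    (ha : Γ.d x₀ a ≤ 3 * R) (hb : Γ.d x₀ b ≤ 3 * R) (hab : R / 2 ≤ Γ.d a b) (hδ0 : 0 ≤ δ)
    {a₁ b₁ : V} (hb₁ : Γ.d b b₁ < R / 64) (hδ : M - e b₁ ≤ δ)
    (ha₁ : Γ.d a a₁ < R / 64) (hδ' : M' - e' a₁ ≤ δ) {F : Finset V}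
    (hF : Γ.closure (Γ.ball x₀ (20 * R)) ⊆ F) {f : V → ℝ} (hf1 : ∀ y, Γ.d x₀ y < R → f y = 1)
    (hf0 : ∀ y, 4 * R ≤ Γ.d x₀ y → f y = 0) :
    1 ≤ H ^ 3328 * (H * ((1 + H) * ((H + H ^ 2177) * δ))) * Γ.form F f f := by
  have hD := finite_ball hΓ x₀ (20 * R)
  obtain ⟨g, hg⟩ := exists_isGreen hΓ hD
  obtain ⟨m, hm0, hm, hk⟩ := hg.sub_le_of_pair hΓ h1 hH hR he hA ha
    (ε := (H + H ^ 2177) * δ) (by positivity) fun p hp =>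
      he.sub_le_of_pair hΓ h1 hH hR he' hA hB ha hb hab hδ0 hb₁ hδ ha₁ hδ' hp
  set η := H * ((1 + H) * ((H + H ^ 2177) * δ)) with hη
  have hη0 : 0 ≤ η := by positivity
  have b1 := Nat.le_ceil (R / 4)
  have b2 := Nat.ceil_lt_add_one (by linarith : 0 ≤ R / 4)
  have b3 := Nat.le_ceil (5 * R)
  have b4 := Nat.ceil_lt_add_one (by linarith : 0 ≤ 5 * R)
  set n := ⌈R / 4⌉₊
  -- The second pole c lies far enough beyond 4R for f to vanish on its whole R/4-neighbourhood,
  -- where g c may exceed T.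
  obtain ⟨c, hc⟩ := exists_sphere hΓ x₀ ⌈5 * R⌉₊
  set T := m + H ^ 3328 * η with hT
  have hT0 : 0 ≤ T := by positivity
  have hthree : ∀ u v w, Γ.d x₀ u ≤ 6 * R → Γ.d x₀ v ≤ 6 * R → Γ.d x₀ w ≤ 6 * R →
      R / 8 ≤ Γ.d u v → R / 8 ≤ Γ.d u w → g u v - m ≤ H ^ 3328 * (g u w - m) := by
    intro u v w hu hv hw huv huw
    exact hH.three_point h1 (k := fun p q => g p q - m) (x₀ := x₀) (L := 13 * R) (t := R / 64)
      (N := 832) (by linarith) (by push_cast; linarith) (fun p q => by rw [hg.symm])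
      (fun p q hp hq => sub_nonneg.2 (hm p q (by linarith) hq))
      (fun p q _ hq hqp => by
        rw [lap_sub_const]
        exact hg.lap_ne p q (Γ.mem_ball.2 (by linarith)) hqp)
      (by linarith) (by linarith) (by linarith) (by linarith) (by linarith)
  have hsph : ∀ p, Γ.d x₀ p ≤ 5 * R + 1 → ∀ z, (n : ℝ) ≤ Γ.d p z → g p z ≤ T := by
    intro p hp z hz
    refine hg.le_of_sphere hΓ hD hT0 (fun q hq => ?_) hz
    have hq6 : Γ.d x₀ q ≤ 6 * R := by linarith [Γ.d_triangle x₀ p q]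
    have hpow : 0 ≤ H ^ 3328 := by positivity
    -- Since p and q are R/4 apart, at least one of them is far from a; it serves as the fixed point
    -- while the other moves to a.
    by_cases hqa : R / 8 ≤ Γ.d a q
    · have e1 := hthree q p a hq6 (by linarith) (by linarith) (by rw [d_comm, hq]; linarith)
        (by rwa [d_comm])
      rw [hg.symm q p, hg.symm q a] at e1
      have := mul_le_mul_of_nonneg_left (hk q (by linarith) (by linarith)) hpow
      linarith
    · have hpa : R / 8 ≤ Γ.d p a := by
        have := Γ.d_triangle p a q
        linarith
      have e1 := hthree p q a (by linarith) hq6 (by linarith) (by rw [hq]; linarith) hpa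
      rw [hg.symm p a] at e1
      rw [d_comm] at hpa
      have := mul_le_mul_of_nonneg_left (hk p (by linarith) (by linarith)) hpow
      linarith
  have hx0 : Γ.d x₀ x₀ = 0 := Γ.d_self x₀
  have hsx := hsph x₀ (by linarith)
  have hsc := hsph c (by linarith)
  have hnear : ∀ p, (∀ z, (n : ℝ) ≤ Γ.d p z → g p z ≤ T) → ∀ y z, Γ.graph.Adj y z → T < g p y →
      Γ.d p y < R / 4 + 1 ∧ Γ.d p z < R / 4 + 2 := by
    intro p hp y z hyz hlt
    have hy : Γ.d p y < n := by
      by_contra! h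
      exact not_lt.2 (hp y h) hlt
    have := Γ.d_le_of_adj p hyz
    exact ⟨by linarith, by linarith⟩
  have hcfar : ∀ z, Γ.d c z < R / 4 + 2 → 4 * R ≤ Γ.d x₀ z := by
    intro z hz
    have := Γ.d_triangle x₀ z c
    rw [Γ.d_comm z c] at this
    linarith
  -- Dipole estimate: 2T - 2 g x₀ c ≤ 2T - 2m, and m disappears.
  have key := hg.one_le_mul_form_pair hF (f := f)
    (fun y hy => hf0 y (by
      have : 20 * R ≤ Γ.d x₀ y := not_lt.1 hy
      linarith)) (p := x₀) (q := c)
    (Γ.mem_ball.2 (by linarith)) (Γ.mem_ball.2 (by linarith)) (hf1 x₀ (by linarith))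
    (hf0 c (by linarith)) hT0 hT0
    (fun y z hyz hlt => by
      obtain ⟨h2, h3⟩ := hnear x₀ hsx y z hyz hlt
      rw [hf1 y (by linarith), hf1 z (by linarith)])
    (fun y z hyz hlt => by
      obtain ⟨h2, h3⟩ := hnear c hsc y z hyz hlt
      rw [hf0 y (hcfar y (by linarith)), hf0 z (hcfar z h3)])
    (hsx c (by linarith))
    (fun y z hyz hlt => by
      obtain ⟨h2, h3⟩ := hnear c hsc y z hyz hlt
      exact ⟨hsx y (by linarith [hcfar y (by linarith)]), hsx z (by linarith [hcfar z h3])⟩)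
    (hsc x₀ (by rw [d_comm]; linarith))
  have hE := form_self_nonneg (Γ := Γ) F f
  have h2 := mul_le_mul_of_nonneg_right (hm x₀ c (by linarith) (by linarith)) hE
  rw [hT] at key
  linarith

end TwoBalls

/-! ### Cut-off functions and coverings -/

lemma form_le_form_of_adj {F : Finset V} {f f' : V → ℝ}
    (h : ∀ x y, Γ.graph.Adj x y → (f x - f y) ^ 2 ≤ (f' x - f' y) ^ 2) :
    Γ.form F f f ≤ Γ.form F f' f' := by
  refine Finset.sum_le_sum fun x _ => Finset.sum_le_sum fun y _ => ?_
  by_cases hxy : Γ.graph.Adj x y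
  · refine mul_le_mul_of_nonneg_left ?_ (w_nonneg x y)
    rw [← pow_two, ← pow_two]
    exact h x y hxy
  · simp [Γ.w_zero x y hxy]

lemma form_one_sub (F : Finset V) (f : V → ℝ) :
    Γ.form F (fun x => 1 - f x) (fun x => 1 - f x) = Γ.form F f f :=
  Finset.sum_congr rfl fun x _ => Finset.sum_congr rfl fun y _ => by ring

lemma form_min_le (F : Finset V) (f g : V → ℝ) :
    Γ.form F (fun x => min (f x) (g x)) (fun x => min (f x) (g x)) ≤
      Γ.form F f f + Γ.form F g g := by
  simp only [form, ← Finset.sum_add_distrib, ← mul_add]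
  refine Finset.sum_le_sum fun x _ => Finset.sum_le_sum fun y _ =>
    mul_le_mul_of_nonneg_left ?_ (w_nonneg x y)
  have h1 := mul_self_nonneg (f x - f y)
  have h2 := mul_self_nonneg (g x - g y)
  rcases le_total (f x) (g x) with hx | hx <;> rcases le_total (f y) (g y) with hy | hy <;>
    simp only [min_eq_left, min_eq_right, hx, hy]
  · linarith
  · rcases le_total (f x) (g y) with h | h <;> nlinarith
  · rcases le_total (g x) (f y) with h | h <;> nlinarith
  · linarith

variable (Γ)

/-- `φ` is a cut-off function, `1` on `A` and `0` on `B`, of energy at most `c` on `F`. -/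
structure IsCutoff (F : Finset V) (A B : Set V) (c : ℝ) (φ : V → ℝ) : Prop where
  nonneg : ∀ x, 0 ≤ φ x
  le_one : ∀ x, φ x ≤ 1
  one : ∀ x ∈ A, φ x = 1
  zero : ∀ x ∈ B, φ x = 0
  form_le : Γ.form F φ φ ≤ c

variable {Γ}

lemma IsCutoff.one_sub {F : Finset V} {A B : Set V} {c : ℝ} {φ : V → ℝ}
    (h : Γ.IsCutoff F A B c φ) : Γ.IsCutoff F B A c fun x => 1 - φ x :=
  ⟨fun x => sub_nonneg.2 (h.le_one x), fun x => sub_le_self _ (h.nonneg x),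
    fun x hx => by rw [h.zero x hx, sub_zero], fun x hx => by rw [h.one x hx, sub_self],
    by rw [form_one_sub]; exact h.form_le⟩

/-- A pointwise minimum of cut-offs stays 1 on A and vanishes wherever one of them does; energies at
most add up. -/
lemma exists_isCutoff_biUnion {F : Finset V} {A : Set V} {B : V → Set V} {c : ℝ} (s : Finset V)
    (h : ∀ b ∈ s, ∃ φ, Γ.IsCutoff F A (B b) c φ) :
    ∃ φ, Γ.IsCutoff F A (⋃ b ∈ s, B b) (s.card * c) φ := by
  classical
  induction s using Finset.induction_on with
  | empty =>
    exact ⟨fun _ => 1, fun _ => zero_le_one, fun _ => le_rfl, fun _ _ => rfl, by simp,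
      by simp [form]⟩
  | insert b s hb ih =>
    obtain ⟨φ, hφ⟩ := ih fun b hb => h b (Finset.mem_insert_of_mem hb)
    obtain ⟨ψ, hψ⟩ := h b (Finset.mem_insert_self b s)
    refine ⟨fun x => min (φ x) (ψ x), fun x => le_min (hφ.nonneg x) (hψ.nonneg x),
      fun x => (min_le_left _ _).trans (hφ.le_one x),
      fun x hx => by rw [hφ.one x hx, hψ.one x hx, min_self], fun x hx => ?_, ?_⟩
    · rw [Finset.set_biUnion_insert] at hx
      rcases hx with hx | hx
      · rw [hψ.zero x hx, min_eq_right (hφ.nonneg x)]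
      · rw [hφ.zero x hx, min_eq_left (hψ.nonneg x)]
    · rw [Finset.card_insert_of_notMem hb]
      push_cast
      linarith [form_min_le (Γ := Γ) F φ ψ, hφ.form_le, hψ.form_le]

lemma exists_isCutoff_biUnion₂ {F : Finset V} {A B : V → Set V} {c : ℝ} (s t : Finset V)
    (h : ∀ a ∈ s, ∀ b ∈ t, ∃ φ, Γ.IsCutoff F (A a) (B b) c φ) :
    ∃ φ, Γ.IsCutoff F (⋃ a ∈ s, A a) (⋃ b ∈ t, B b) (s.card * (t.card * c)) φ := by
  obtain ⟨φ, hφ⟩ := exists_isCutoff_biUnion (Γ := Γ) (F := F) (A := ⋃ b ∈ t, B b) (B := A) s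
    fun a ha => by
      obtain ⟨φ, hφ⟩ := exists_isCutoff_biUnion t (h a ha)
      exact ⟨_, hφ.one_sub⟩
  exact ⟨_, hφ.one_sub⟩

lemma BoundedCovering.exists_cover (h : Γ.BoundedCovering) : ∃ K : ℕ, ∀ (j : ℕ) (x : V) (R : ℝ),
    0 < R → ∃ s : Finset V, s.card ≤ K ^ j ∧ Γ.ball x (2 ^ j * R) ⊆ ⋃ c ∈ s, Γ.ball c R := by
  classical
  obtain ⟨K, hK⟩ := h
  refine ⟨K, fun j => ?_⟩
  induction j with
  | zero => exact fun x R _ => ⟨{x}, by simp, by simp⟩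
  | succ j ih =>
    intro x R hR
    obtain ⟨s, hs, hcov⟩ := ih x (2 * R) (by linarith)
    choose t ht htcov using fun c : V => hK c R hR
    refine ⟨s.biUnion t, ?_, ?_⟩
    · calc (s.biUnion t).card ≤ s.card * K := Finset.card_biUnion_le_card_mul _ _ _ fun c _ => ht c
        _ ≤ K ^ j * K := Nat.mul_le_mul_right _ hs
        _ = K ^ (j + 1) := (pow_succ _ _).symm
    · intro y hy
      have e : (2 : ℝ) ^ (j + 1) * R = 2 ^ j * (2 * R) := by ring
      rw [e] at hy
      obtain ⟨c, hc, hyc⟩ := Set.mem_iUnion₂.1 (hcov hy)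
      obtain ⟨c', hc', hyc'⟩ := Set.mem_iUnion₂.1 (htcov c hyc)
      exact Set.mem_iUnion₂.2 ⟨c', Finset.mem_biUnion.2 ⟨c, hc, hc'⟩, hyc'⟩

/-- A truncated equilibrium potential as a cut-off function. -/
lemma IsEquilibrium.isCutoff {D : Set V} {A : Finset V} {e : V → ℝ} {M : ℝ}
    (he : Γ.IsEquilibrium D A e M) {F : Finset V} (hF : Γ.closure D ⊆ F) {δ : ℝ} (hδ : 0 < δ)
    (hδM : δ ≤ M) {B : Set V} (hB : ∀ b ∈ B, δ ≤ M - e b) :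
    Γ.IsCutoff F A B (2 / δ) fun x => δ⁻¹ * max (e x - (M - δ)) 0 := by
  refine ⟨fun x => mul_nonneg (inv_pos.2 hδ).le (le_max_right _ _), fun x => ?_, fun x hx => ?_,
    fun x hx => ?_, ?_⟩
  · rw [inv_mul_le_iff₀ hδ, mul_one]
    exact max_le (by linarith [he.le x]) hδ.le
  · rw [he.eq x hx, sub_sub_cancel, max_eq_left hδ.le, inv_mul_cancel₀ hδ.ne']
  · rw [max_eq_right (by linarith [hB x hx]), mul_zero]
  · rw [form_const_mul_self]
    -- Pairing with e only sees the charge on A, where the truncation equals δ: this gives 2δ,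
    -- divided by δ² after normalisation.
    have h1 : Γ.form F (fun x => max (e x - (M - δ)) 0) (fun x => max (e x - (M - δ)) 0) ≤
        Γ.form F (fun x => max (e x - (M - δ)) 0) e := by
      refine form_le_form fun x y => ?_
      rcases le_total (e x - (M - δ)) 0 with hx | hx <;>
        rcases le_total (e y - (M - δ)) 0 with hy | hy <;>
        simp only [max_eq_left, max_eq_right, hx, hy] <;> nlinarith
    rw [he.form_eq hF fun x hx => by rw [he.zero x hx, max_eq_right (by linarith)]] at h1
    have h2 : ∑ a ∈ A, Γ.lap e a * max (e a - (M - δ)) 0 ≤ δ :=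
      he.sum_le fun a ha => by rw [he.eq a ha, sub_sub_cancel, max_eq_left hδ.le]
    have h3 := mul_le_mul_of_nonneg_left (h1.trans (mul_le_mul_of_nonneg_left h2 zero_le_two))
      (by positivity : 0 ≤ δ⁻¹ ^ 2)
    refine h3.trans (le_of_eq ?_)
    field_simp

/-- Cut-off functions between separated balls, of energy controlled by the capacity of the
annulus. -/
lemma exists_isCutoff_balls [Infinite V] (hΓ : Γ.LocFin) {H : ℝ} (h1 : 1 ≤ H)
    (hH : Γ.HarnackWith H) {R : ℝ} (hR : 256 ≤ R) {x₀ a b : V}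
    (ha : Γ.d x₀ a ≤ 3 * R) (hb : Γ.d x₀ b ≤ 3 * R) (hab : R / 2 ≤ Γ.d a b) {F : Finset V}
    (hF : Γ.closure (Γ.ball x₀ (20 * R)) ⊆ F) {f : V → ℝ} (hf1 : ∀ y, Γ.d x₀ y < R → f y = 1)
    (hf0 : ∀ y, 4 * R ≤ Γ.d x₀ y → f y = 0) :
    ∃ φ, Γ.IsCutoff F (Γ.ball a (R / 64)) (Γ.ball b (R / 64))
      (4 * (H ^ 3328 * (H * ((1 + H) * (H + H ^ 2177)))) * Γ.form F f f) φ := by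
  have hD := finite_ball hΓ x₀ (20 * R)
  set K := H ^ 3328 * (H * ((1 + H) * (H + H ^ 2177))) with hK
  have hK0 : 0 < K := by positivity
  have hmemA : ∀ c y, y ∈ (finite_ball hΓ c (R / 64)).toFinset ↔ Γ.d c y < R / 64 := by
    intro c y; simp [mem_ball]
  have hex : ∀ c, Γ.d x₀ c ≤ 3 * R → ∃ e M, Γ.IsEquilibrium (Γ.ball x₀ (20 * R))
      (finite_ball hΓ c (R / 64)).toFinset e M := by
    intro c hc
    refine exists_isEquilibrium hΓ hD ⟨c, (hmemA c c).2 (by rw [d_self]; linarith)⟩ fun y hy => ?_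
    have := (hmemA c y).1 hy
    exact Γ.mem_ball.2 (by linarith [Γ.d_triangle x₀ c y])
  obtain ⟨e, M, he⟩ := hex a ha
  obtain ⟨e', M', he'⟩ := hex b hb
  have hself : ∀ c, Γ.d c c < R / 64 := fun c => by rw [d_self]; linarith
  have key : ∀ δ, 0 ≤ δ → ∀ a₁ b₁, Γ.d b b₁ < R / 64 → M - e b₁ ≤ δ → Γ.d a a₁ < R / 64 →
      M' - e' a₁ ≤ δ → 1 ≤ K * δ * Γ.form F f f := by
    intro δ hδ a₁ b₁ hb₁ hb₂ ha₁ ha₂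
    have := one_le_mul_form_of_pair hΓ h1 hH hR he he' (fun y hy => (hmemA a y).1 hy)
      (fun y hy => (hmemA b y).1 hy) ha hb hab hδ hb₁ hb₂ ha₁ ha₂ hF hf1 hf0
    rw [hK]
    linarith
  have hM := he.pos
  have hM' := he'.pos
  -- For δ = M + M' the hypotheses of `key` hold trivially, and `key` excludes zero energy.
  have hE : 0 < Γ.form F f f := by
    refine lt_of_le_of_ne (form_self_nonneg F f) fun h => ?_
    have := key (M + M') (by positivity) a b (hself b) (by linarith [he.nonneg b]) (hself a)
      (by linarith [he'.nonneg a])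
    rw [← h, mul_zero] at this
    linarith
  -- With this δ the bound in `key` would read 1 ≤ 1/2, so one of the potentials drops by δ
  -- throughout the opposite ball.
  set δ := (2 * K * Γ.form F f f)⁻¹ with hδ
  have hδ0 : 0 < δ := by positivity
  have hδK : K * δ * Γ.form F f f = 1 / 2 := by rw [hδ]; field_simp
  have hδ2 : 2 / δ = 4 * K * Γ.form F f f := by rw [hδ]; field_simp; ring
  rw [← hδ2]
  by_cases hcase : ∀ b₁, Γ.d b b₁ < R / 64 → δ ≤ M - e b₁
  · have := he.isCutoff hF hδ0 (by linarith [hcase b (hself b), he.nonneg b])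
      (B := Γ.ball b (R / 64)) fun y hy => hcase y hy
    rw [Set.Finite.coe_toFinset] at this
    exact ⟨_, this⟩
  · push Not at hcase
    obtain ⟨b₁, hb₁, hb₂⟩ := hcase
    have hcase' : ∀ a₁, Γ.d a a₁ < R / 64 → δ ≤ M' - e' a₁ := by
      intro a₁ ha₁
      by_contra! hlt
      have := key δ hδ0.le a₁ b₁ hb₁ hb₂.le ha₁ hlt.le
      linarith
    have := he'.isCutoff hF hδ0 (by linarith [hcase' a (hself a), he'.nonneg a])
      (B := Γ.ball a (R / 64)) fun y hy => hcase' y hy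
    rw [Set.Finite.coe_toFinset] at this
    exact ⟨_, this.one_sub⟩

/-! ### The outer radius at large scales -/

/-- Decreasing the outer radius of an annulus, at large scales. -/
lemma HarnackWith.rho_le_mul_rho_of_cover [Infinite V] (hΓ : Γ.LocFin) {H : ℝ} (h1 : 1 ≤ H)
    (hH : Γ.HarnackWith H) {K : ℕ} (hK : ∀ (x : V) (R : ℝ), 0 < R →
      ∃ s : Finset V, s.card ≤ K ∧ Γ.ball x (2 ^ 8 * R) ⊆ ⋃ c ∈ s, Γ.ball c R)
    {C : ℝ≥0} (hC0 : 0 < C)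
    (hC : K * (K * (4 * (H ^ 3328 * (H * ((1 + H) * (H + H ^ 2177)))))) ≤ (C : ℝ)) {x : V}
    {R : ℝ} (hR : 256 ≤ R) : Γ.rho x R (4 * R) ≤ C * Γ.rho x R (2 * R) := by
  classical
  have hcl := hΓ.finite_closure (finite_ball hΓ x (20 * R))
  have hF : Γ.closure (Γ.ball x (20 * R)) ⊆ hcl.toFinset := by simp
  have hmono : ∀ r ≤ 20 * R, Γ.closure (Γ.ball x r) ⊆ hcl.toFinset := by
    intro r hr y hy
    refine hF ?_
    rcases hy with hy | ⟨z, hz, hzy⟩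
    · exact Or.inl (Γ.mem_ball.2 (by linarith [Γ.mem_ball.1 hy]))
    · exact Or.inr ⟨z, Γ.mem_ball.2 (by linarith [Γ.mem_ball.1 hz]), hzy⟩
  refine rho_le_mul hΓ (hmono _ (by linarith)) (hmono _ (by linarith)) hC0 fun f hf1 hf0 => ?_
  set F := hcl.toFinset
  have b1 := Nat.le_ceil (2 * R)
  have b2 := Nat.ceil_lt_add_one (by linarith : 0 ≤ 2 * R)
  set n := ⌈2 * R⌉₊
  obtain ⟨s, hs, hcov⟩ := hK x (R / 64) (by linarith)
  -- The covering balls have radius R/64 and cover B(x,4R). Those kept meet B(x,R), respectively the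
  -- sphere of radius n, so centres from the two families are at least R/2 apart.
  set s₁ := s.filter fun c => ∃ y, Γ.d x y < R ∧ Γ.d c y < R / 64 with hs₁
  set s₂ := s.filter fun c => ∃ y, Γ.d x y = n ∧ Γ.d c y < R / 64 with hs₂
  obtain ⟨φ, hφ⟩ := exists_isCutoff_biUnion₂ (Γ := Γ) (F := F) (A := fun a => Γ.ball a (R / 64))
    (B := fun b => Γ.ball b (R / 64)) s₁ s₂ fun a ha b hb => by
      obtain ⟨y, hy, hay⟩ := (Finset.mem_filter.1 ha).2
      obtain ⟨z, hz, hbz⟩ := (Finset.mem_filter.1 hb).2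
      have t1 := Γ.d_triangle x y a
      have t2 := Γ.d_triangle x z b
      have t3 := Γ.d_triangle x a z
      have t4 := Γ.d_triangle a b z
      rw [Γ.d_comm y a] at t1
      rw [Γ.d_comm z b] at t2
      exact exists_isCutoff_balls hΓ h1 hH hR (x₀ := x) (by linarith) (by linarith) (by linarith)
        hF hf1 hf0
  have hcov' : ∀ y, Γ.d x y < 4 * R → ∃ c ∈ s, Γ.d c y < R / 64 := by
    intro y hy
    obtain ⟨c, hc, hyc⟩ := Set.mem_iUnion₂.1
      (hcov (Γ.mem_ball.2 (by linarith) : y ∈ Γ.ball x (2 ^ 8 * (R / 64))))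
    exact ⟨c, hc, hyc⟩
  have hone : ∀ y, Γ.d x y < R → φ y = 1 := by
    intro y hy
    obtain ⟨c, hc, hyc⟩ := hcov' y (by linarith)
    exact hφ.one y (Set.mem_iUnion₂.2 ⟨c, Finset.mem_filter.2 ⟨hc, y, hy, hyc⟩, hyc⟩)
  have hzero : ∀ y, Γ.d x y = n → φ y = 0 := by
    intro y hy
    obtain ⟨c, hc, hyc⟩ := hcov' y (by linarith)
    exact hφ.zero y (Set.mem_iUnion₂.2 ⟨c, Finset.mem_filter.2 ⟨hc, y, hy, hyc⟩, hyc⟩)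
  have hedge : ∀ y z, Γ.graph.Adj y z → Γ.d x y < 2 * R → ¬ Γ.d x z < 2 * R → φ z = 0 := by
    intro y z hyz hy hz
    have h2 := Γ.d_le_of_adj x hyz
    refine hzero z (d_eq_nat (by linarith) ?_)
    have h3 : Γ.d x z < n + 1 := by linarith
    unfold d at h3 ⊢
    have h4 : Γ.graph.dist x z < n + 1 := by exact_mod_cast h3
    exact_mod_cast Nat.lt_succ_iff.1 h4
  -- Edges leaving B(x,2R) end on the sphere of radius n, where φ = 0, so cutting φ off there costs
  -- no energy.
  refine ⟨fun y => if Γ.d x y < 2 * R then φ y else 0, fun y hy => ?_, fun y hy => ?_, ?_⟩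
  · beta_reduce
    rw [if_pos (by linarith), hone y hy]
  · exact if_neg (not_lt.2 hy)
  · have hcut : Γ.form F (fun y => if Γ.d x y < 2 * R then φ y else 0)
        (fun y => if Γ.d x y < 2 * R then φ y else 0) ≤ Γ.form F φ φ := by
      refine form_le_form_of_adj fun y z hyz => ?_
      by_cases hy : Γ.d x y < 2 * R <;> by_cases hz : Γ.d x z < 2 * R
      · simp only [if_pos hy, if_pos hz]; exact le_rfl
      · simp only [if_pos hy, if_neg hz, hedge y z hyz hy hz]; exact le_rfl
      · simp only [if_neg hy, if_pos hz, hedge z y hyz.symm hz hy]; exact le_rfl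
      · simp only [if_neg hy, if_neg hz, sub_self]
        simpa using sq_nonneg (φ y - φ z)
    refine hcut.trans (hφ.form_le.trans ?_)
    have hE := form_self_nonneg (Γ := Γ) F f
    have c1 : (s₁.card : ℝ) ≤ K := by exact_mod_cast (Finset.card_filter_le _ _).trans hs
    have c2 : (s₂.card : ℝ) ≤ K := by exact_mod_cast (Finset.card_filter_le _ _).trans hs
    calc _ ≤ (K : ℝ) * (K * (4 * (H ^ 3328 * (H * ((1 + H) * (H + H ^ 2177)))) *
          Γ.form F f f)) := by gcongr
      _ = K * (K * (4 * (H ^ 3328 * (H * ((1 + H) * (H + H ^ 2177)))))) * Γ.form F f f := by ring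
      _ ≤ _ := mul_le_mul_of_nonneg_right hC hE

end WeightedGraph

/-! ### Assembling all scales -/

theorem mainTheorem3 {V : Type*} [Countable V] [Infinite V] (Γ : WeightedGraph V)
    (hp : Γ.P0) (hH : Γ.Harnack) :
    (∃ C₂ : ℝ≥0, 1 < C₂ ∧ ∀ (x : V) (R : ℝ), 0 ≤ R →
      Γ.rho x R (4 * R) ≤ C₂ * Γ.rho x (2 * R) (4 * R)) ∧
    (Γ.BoundedCovering →
      ∃ C₁ : ℝ≥0, 1 < C₁ ∧ ∀ (x : V) (R : ℝ), 0 ≤ R →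
        Γ.rho x R (4 * R) ≤ C₁ * Γ.rho x R (2 * R)) := by
  obtain ⟨p₀, h0, hp⟩ := hp
  have hΓ := WeightedGraph.locFin_of_le h0 hp
  obtain ⟨H, h1, hH⟩ := hH.exists_harnackWith hΓ
  obtain ⟨C, hC⟩ := WeightedGraph.exists_rho_le_mul_of_le h0 hp 1024
  -- At R = 0 both resistances are the same; for 0 < R < 256 all radii are at most 1024 and (p₀)
  -- suffices; beyond that the large-scale bound applies.
  have reduce : ∀ (C' : ℝ≥0) (r R' : ℝ → ℝ), r 0 = 0 → R' 0 = 0 → (∀ R, 0 ≤ R → r R ≤ R' R) →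
      (∀ R, 0 ≤ R → R' R ≤ 4 * R) →
      (∀ x R, 256 ≤ R → Γ.rho x R (4 * R) ≤ C' * Γ.rho x (r R) (R' R)) →
      ∃ C'' : ℝ≥0, 1 < C'' ∧ ∀ (x : V) (R : ℝ), 0 ≤ R →
        Γ.rho x R (4 * R) ≤ C'' * Γ.rho x (r R) (R' R) := by
    intro C' r R' hr0 hR0 hrR hR4 hlarge
    refine ⟨C + C' + 2, lt_of_lt_of_le one_lt_two le_add_self, fun x R hR => ?_⟩
    rcases hR.eq_or_lt with rfl | hpos
    · rw [hr0, hR0, mul_zero]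
      refine le_mul_of_one_le_left zero_le ?_
      exact_mod_cast one_le_two.trans (le_add_self : (2 : ℝ≥0) ≤ C + C' + 2)
    · by_cases hb : 256 ≤ R
      · refine (hlarge x R hb).trans (mul_le_mul_left ?_ _)
        exact_mod_cast (le_add_self.trans le_self_add : C' ≤ C + C' + 2)
      · push Not at hb
        refine (hC x R (4 * R) (r R) (R' R) hpos (by push_cast; linarith) (hrR R hR)
          (by push_cast; linarith [hR4 R hR])).trans (mul_le_mul_left ?_ _)
        rw [add_assoc]
        exact_mod_cast (le_self_add : C ≤ C + (C' + 2))
  constructor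
  · obtain ⟨C', hC'⟩ : ∃ C : ℝ≥0, (C : ℝ) = H ^ 1024 := ⟨_, Real.coe_toNNReal _ (by positivity)⟩
    exact reduce C' (fun R => 2 * R) (fun R => 4 * R) (mul_zero _) (mul_zero _)
      (fun R hR => by linarith) (fun R hR => le_rfl)
      fun x R hR => hH.rho_le_mul_rho_two_mul hΓ h1.le hC' hR
  · intro hBC
    obtain ⟨K, hK⟩ := hBC.exists_cover
    obtain ⟨C', hC'⟩ : ∃ C : ℝ≥0, (C : ℝ) = (K ^ 8 : ℕ) * ((K ^ 8 : ℕ) *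
        (4 * (H ^ 3328 * (H * ((1 + H) * (H + H ^ 2177)))))) + 1 :=
      ⟨_, Real.coe_toNNReal _ (by positivity)⟩
    exact reduce C' (fun R => R) (fun R => 2 * R) rfl (mul_zero _)
      (fun R hR => by linarith) (fun R hR => by linarith)
      fun x R hR => hH.rho_le_mul_rho_of_cover hΓ h1.le (hK 8)
        (by rw [← NNReal.coe_pos, hC']; positivity) (by rw [hC']; linarith) hR
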